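/- Let $n\ge 1$, let $\mathbb D^n=\{z\in\mathbb C^n: |z_i|<1 \text{ for all } i\}$ and $\mathbb B_n=\{z\in\mathbb C^n: |z|<1\}$, with $\langle z,w\rangle=\sum_i z_i\overline{w_i}$ and $|z|^2=\langle z,z\rangle$. The Hardy space $H^2(\mathbb D^n)$ (respectively $H^2(\mathbb B_n)$) consists of the holomorphic functions $f$ on $\mathbb D^n$ (respectively $\mathbb B_n$) with $$\|f\|^2=\sup_{0\le r<1}\int |f(r\zeta)|^2\,d\mu(\zeta)<\infty,$$ where $\mu$ is the normalized Haar measure on the torus $\mathbb T^n$ (respectively the normalized surface measure on the unit sphere of $\mathbb C^n$). A function $K:X\times X\to\mathbb C$ is called a kernel on $X$ if for every finite choice of points $x_1,\dots,x_m\in X$ the matrix $[K(x_i,x_j)]_{i,j}$ is positive semidefinite. For a holomorphic self-map $\varphi$ of $\mathbb D^n$ or $\mathbb B_n$, the composition operator $C_\varphi f=f\circ\varphi$ is said to be bounded on $H^2$ if it maps $H^2$ into itself and there is a constant $C<\infty$ with $\|f\circ\varphi\|\le C\|f\|$ for all $f\in H^2$. 1. Let $\varphi=(\varphi_1,\dots,\varphi_n)$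 be a holomorphic self-map of $\mathbb D^n$. If $$(z,w)\mapsto\prod_{i=1}^n\frac{1-\overline{\varphi_i(w)}\,\varphi_i(z)}{1-\overline{w_i}\,z_i}$$ is a kernel on $\mathbb D^n$, then $C_\varphi$ is bounded on $H^2(\mathbb D^n)$. 2. Let $\varphi$ be a holomorphic self-map of $\mathbb B_n$. If $$(z,w)\mapsto\left(\frac{1-\langle\varphi(z),\varphi(w)\rangle}{1-\langle z,w\rangle}\right)^n$$ is a kernel on $\mathbb B_n$, then $C_\varphi$ is bounded on $H^2(\mathbb B_n)$. 3. If $\varphi$ is an automorphism of $\mathbb D^n$ (a holomorphic self-map with a holomorphic inverse), then $C_\varphi$ is bounded on $H^2(\mathbb D^n)$; if $\varphi$ is an automorphism of $\mathbb B_n$, then $C_\varphi$ is bounded on $H^2(\mathbb B_n)$. -/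

import Mathlib

open MeasureTheory
open scoped ENNReal NNReal ComplexConjugate ComplexOrder

noncomputable section

namespace HardyComp

/-- The underlying Hermitian space of the unit ball: complex `n`-space with the Euclidean norm. -/
abbrev Cn (n : ℕ) : Type := EuclideanSpace ℂ (Fin n)

/-- The open unit polydisc in complex `n`-space. -/
def polydisc (n : ℕ) : Set (Fin n → ℂ) := {z | ∀ i, ‖z i‖ < 1}

/-- The open unit (Euclidean) ball in complex `n`-space. -/
def unitBall (n : ℕ) : Set (Cn n) := {z | ‖z‖ < 1}

/-- A function `K` of two variables is a kernel on the set `D` if for every finite family of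
points of `D` the matrix of its values is positive semidefinite. -/
def IsKernelOn {X : Type*} (D : Set X) (K : X → X → ℂ) : Prop :=
  ∀ (m : ℕ) (x : Fin m → X), (∀ i, x i ∈ D) →
    (Matrix.of fun i j => K (x i) (x j)).PosSemidef

/-- The `H²`-norm on the polydisc, with values in `[0, ∞]`: the square root of the supremum over
`0 ≤ r < 1` of the integral of `|f (r z)|²` over the distinguished boundary. The latter is
parametrized by `z i = exp (2 π i t i)`, with `t` in the product of `n` copies of `ℝ / ℤ`, carrying
the product of the normalized Haar measures. -/
def polydiscHardyNorm {n : ℕ} (f : (Fin n → ℂ) → ℂ) : ℝ≥0∞ :=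
  (⨆ r ∈ Set.Ico (0 : ℝ) 1,
    ∫⁻ t : UnitAddTorus (Fin n),
      ‖f (fun i => (r : ℂ) * (AddCircle.toCircle (t i) : ℂ))‖ₑ ^ 2
        ∂(Measure.pi fun _ => AddCircle.haarAddCircle)) ^ (1 / 2 : ℝ)

/-- The Hardy space `H²` of the polydisc: the functions that are holomorphic on the polydisc and
have finite norm. Values outside the polydisc play no role. -/
def polydiscHardySpace (n : ℕ) : Set ((Fin n → ℂ) → ℂ) :=
  {f | DifferentiableOn ℂ f (polydisc n) ∧ polydiscHardyNorm f < ∞}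

/-- The surface measure of the unit sphere of complex `n`-space, normalized to total mass one
(for `n ≥ 1`). The normalization makes the choice of the Haar measure immaterial. -/
def sphereMeasure (n : ℕ) : Measure (Metric.sphere (0 : Cn n) 1) :=
  ((Measure.addHaar : Measure (Cn n)).toSphere Set.univ)⁻¹ •
    (Measure.addHaar : Measure (Cn n)).toSphere

/-- The `H²`-norm on the ball, with values in `[0, ∞]`: the square root of the supremum over
`0 ≤ r < 1` of the integral of `|f (r ζ)|²` over the unit sphere. -/
def ballHardyNorm {n : ℕ} (f : Cn n → ℂ) : ℝ≥0∞ :=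
  (⨆ r ∈ Set.Ico (0 : ℝ) 1,
    ∫⁻ ζ : Metric.sphere (0 : Cn n) 1,
      ‖f ((r : ℂ) • (ζ : Cn n))‖ₑ ^ 2 ∂(sphereMeasure n)) ^ (1 / 2 : ℝ)

/-- The Hardy space `H²` of the ball: the functions that are holomorphic on the ball and have
finite norm. Values outside the ball play no role. -/
def ballHardySpace (n : ℕ) : Set (Cn n → ℂ) :=
  {f | DifferentiableOn ℂ f (unitBall n) ∧ ballHardyNorm f < ∞}

/-- The composition operator `f ↦ f ∘ φ` is a bounded operator on the space `H` of functions with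
the norm `N`: it maps `H` into itself and does not increase norms by more than a constant factor. -/
def BoundedComp {X : Type*} (H : Set (X → ℂ)) (N : (X → ℂ) → ℝ≥0∞) (φ : X → X) : Prop :=
  ∃ C : ℝ≥0, ∀ f ∈ H, f ∘ φ ∈ H ∧ N (f ∘ φ) ≤ C * N f

/-- `φ` is a holomorphic self-map of `D`. -/
def IsHolSelfMap {E : Type*} [NormedAddCommGroup E] [NormedSpace ℂ E] (D : Set E) (φ : E → E) :
    Prop :=
  DifferentiableOn ℂ φ D ∧ Set.MapsTo φ D D

/-- `φ` is an automorphism of `D`: a holomorphic self-map of `D` with a holomorphic inverse. -/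
def IsHolAut {E : Type*} [NormedAddCommGroup E] [NormedSpace ℂ E] (D : Set E) (φ : E → E) :
    Prop :=
  IsHolSelfMap D φ ∧ ∃ ψ : E → E, IsHolSelfMap D ψ ∧ Set.InvOn ψ φ D D

end HardyComp

end

/-! Both domains are treated at once through an abstract Szegő kernel `k`, which reproduces
holomorphic functions from the dilates `g (r ζ)` on a distinguished boundary. Write `K ≥ 0` for "`K`
is a kernel". The Hardy norm is characterized by positivity: for holomorphic `f`, one has `‖f‖ ≤ N`
exactly when `N² k(z,w) - f(z) conj(f(w)) ≥ 0` (`isKernelOn_sub` and `hardyNorm_le_of_isKernelOn`).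

Let `L(z,w) = k(z,w) / k(φ z, φ w) ≥ 0` and `a = φ 0`. Since `k(·,0)` is constant, the Schur
complement of `L` at `0` says `L(z,w) ≥ k(0,0) k(a,a) g(z) conj(g(w))` with `g = 1 / k(φ ·, a)`. By
the Schur product theorem this may be multiplied by `k(φ z, φ w)`. Combined with the positivity
criterion for `f`, pulled back along `φ`, it puts `g · (f ∘ φ)` in the Hardy space with norm at most
`‖f‖ / √(k(0,0) k(a,a))`. Finally `1 / g = k(φ ·, a)` is bounded, so it can be multiplied away
(`IsSzegoKernel.boundedComp`).

It remains to verify the reproducing formula (iterated Cauchy formula on the polydisc, unitary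
invariance and moments of a coordinate on the sphere) and, for automorphisms, the kernel hypothesis.
An automorphism is a Möbius involution followed by an automorphism fixing `0`. By the Schwarz lemma
the latter is a linear isometry on the domain, which leaves `k` unchanged, and for the involution
the quotient is of the form `G(z) conj(G(w))`. -/

noncomputable section

namespace HardyComp

/-! ### Positive semidefinite kernels: Schur products and Schur complements. -/

section Kernel

variable {X Y : Type*} {D : Set X} {K L : X → X → ℂ}

theorem isKernelOn_iff :
    IsKernelOn D K ↔ (∀ z ∈ D, ∀ w ∈ D, conj (K z w) = K w z) ∧
      ∀ (m : ℕ) (x : Fin m → X), (∀ i, x i ∈ D) → ∀ c : Fin m → ℂ,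
        0 ≤ ∑ i, ∑ j, conj (c i) * K (x i) (x j) * c j := by
  have key : ∀ (m : ℕ) (x : Fin m → X) (c : Fin m → ℂ),
      star c ⬝ᵥ ((Matrix.of fun i j => K (x i) (x j)).mulVec c) =
        ∑ i, ∑ j, conj (c i) * K (x i) (x j) * c j := by
    intro m x c
    simp only [dotProduct, Matrix.mulVec, Matrix.of_apply, Pi.star_apply, Finset.mul_sum,
      RCLike.star_def, mul_assoc]
  constructor
  · intro h
    refine ⟨fun z hz w hw => ?_, fun m x hx c => ?_⟩
    · have h2 := (h 2 ![z, w] (by intro i; fin_cases i <;> simpa)).isHermitian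
      have := congrFun (congrFun h2 1) 0
      simpa [Matrix.conjTranspose_apply] using this
    · rw [← key]
      exact (Matrix.posSemidef_iff_dotProduct_mulVec.1 (h m x hx)).2 c
  · rintro ⟨h1, h2⟩ m x hx
    refine Matrix.PosSemidef.of_dotProduct_mulVec_nonneg ?_ fun c => ?_
    · ext i j
      simpa [Matrix.conjTranspose_apply] using h1 _ (hx j) _ (hx i)
    · rw [key]
      exact h2 m x hx c

theorem IsKernelOn.congr (h : IsKernelOn D K) (hKL : ∀ z ∈ D, ∀ w ∈ D, K z w = L z w) :
    IsKernelOn D L := by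
  intro m x hx
  convert h m x hx using 1
  ext i j
  exact (hKL _ (hx i) _ (hx j)).symm

theorem IsKernelOn.add (hK : IsKernelOn D K) (hL : IsKernelOn D L) :
    IsKernelOn D (fun z w => K z w + L z w) :=
  fun m x hx => (hK m x hx).add (hL m x hx)

/-- Schur product theorem for kernels. -/
theorem IsKernelOn.mul (hK : IsKernelOn D K) (hL : IsKernelOn D L) :
    IsKernelOn D (fun z w => K z w * L z w) :=
  fun m x hx => (hK m x hx).hadamard (hL m x hx)

theorem IsKernelOn.comp {D' : Set Y} (hK : IsKernelOn D K) {φ : Y → X} (hφ : Set.MapsTo φ D' D) :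
    IsKernelOn D' (fun z w => K (φ z) (φ w)) :=
  fun m x hx => hK m (φ ∘ x) fun i => hφ (hx i)

theorem isKernelOn_mul_conj (D : Set X) (g : X → ℂ) : IsKernelOn D fun z w => g z * conj (g w) :=
  fun _ x _ => Matrix.posSemidef_vecMulVec_self_star fun i => g (x i)

theorem isKernelOn_const (D : Set X) {a : ℝ} (ha : 0 ≤ a) : IsKernelOn D fun _ _ => (a : ℂ) := by
  refine (isKernelOn_mul_conj D fun _ => ((√a : ℝ) : ℂ)).congr fun _ _ _ _ => ?_
  rw [Complex.conj_ofReal, ← Complex.ofReal_mul, Real.mul_self_sqrt ha]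

/-- The Schur complement of a kernel with respect to a point. -/
theorem IsKernelOn.schur_complement (hK : IsKernelOn D K) {a : X} (ha : a ∈ D) (h0 : 0 < K a a) :
    IsKernelOn D (fun z w => K z w - K z a * K a w / K a a) := by
  have hne : K a a ≠ 0 := h0.ne'
  obtain ⟨h1, h2⟩ := isKernelOn_iff.1 hK
  refine isKernelOn_iff.2 ⟨fun z hz w hw => ?_, fun m x hx c => ?_⟩
  · simp only [map_sub, map_div₀, map_mul, h1 _ hz _ hw, h1 _ hz _ ha, h1 _ ha _ hw, h1 _ ha _ ha]
    ring
  · set s : ℂ := ∑ j, K a (x j) * c j with hs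
    have hs' : conj s = ∑ i, conj (c i) * K (x i) a := by
      rw [hs, map_sum]
      exact Finset.sum_congr rfl fun j _ => by rw [map_mul, h1 _ ha _ (hx j), mul_comm]
    -- The weight `-s / K a a` at the added point `a` minimizes the enlarged quadratic form; the
    -- minimum is the form of the Schur complement.
    have h3 := h2 (m + 1) (Fin.cons a x) (Fin.cases ha hx) (Fin.cons (-s / K a a) c)
    simp only [Fin.sum_univ_succ, Fin.cons_zero, Fin.cons_succ] at h3
    convert h3 using 1
    have e1 : ∀ t : ℂ, ∑ j, t * K a (x j) * c j = t * s := fun t => by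
      rw [hs, Finset.mul_sum]
      exact Finset.sum_congr rfl fun j _ => mul_assoc _ _ _
    have e2 : ∀ t : ℂ, ∑ i, conj (c i) * K (x i) a * t = conj s * t := fun t => by
      rw [hs', Finset.sum_mul]
    rw [e1, Finset.sum_add_distrib, e2]
    have e3 : ∑ i, ∑ j, conj (c i) * (K (x i) (x j) - K (x i) a * K a (x j) / K a a) * c j =
        ∑ i, ∑ j, conj (c i) * K (x i) (x j) * c j - conj s * s / K a a := by
      rw [hs', hs, Finset.sum_mul_sum, Finset.sum_div, ← Finset.sum_sub_distrib]
      refine Finset.sum_congr rfl fun i _ => ?_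
      rw [Finset.sum_div, ← Finset.sum_sub_distrib]
      exact Finset.sum_congr rfl fun j _ => by ring
    rw [e3, map_div₀, map_neg, h1 _ ha _ ha]
    field_simp
    ring

end Kernel

/-! ### From finite positive semidefiniteness to nonnegative double integrals. -/

section Integral

variable {S : Type*} [MeasurableSpace S] (μ : Measure S) [IsProbabilityMeasure μ]

theorem measurePreserving_eval_pair {m : ℕ} {i j : Fin m} (hij : i ≠ j) :
    MeasurePreserving (fun x : Fin m → S => (x i, x j)) (Measure.pi fun _ => μ) (μ.prod μ) := by
  refine ⟨by fun_prop, ?_⟩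
  have h := ProbabilityTheory.iIndepFun_pi (μ := fun _ : Fin m => μ) (X := fun _ => id)
    (fun _ => aemeasurable_id)
  have h2 := h.indepFun hij
  simp only [id] at h2
  rw [ProbabilityTheory.indepFun_iff_map_prod_eq_prod_map_map
    (measurable_pi_apply i).aemeasurable (measurable_pi_apply j).aemeasurable] at h2
  have e : ∀ i : Fin m, Measure.map (fun x : Fin m → S => x i) (Measure.pi fun _ => μ) = μ :=
    fun i => (measurePreserving_eval (fun _ : Fin m => μ) i).map_eq
  simpa [e] using h2

/-- The double integral of a function of two variables that is positive semidefinite on finite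
families of points is nonnegative. -/
theorem integral_prod_nonneg_of_sum_nonneg {F : S × S → ℝ} (hF : Integrable F (μ.prod μ))
    (hd : Integrable (fun x => F (x, x)) μ)
    (h : ∀ (m : ℕ) (x : Fin m → S), 0 ≤ ∑ i, ∑ j, F (x i, x j)) :
    0 ≤ ∫ p, F p ∂(μ.prod μ) := by
  set b := ∫ p, F p ∂(μ.prod μ) with hb
  set a := ∫ x, F (x, x) ∂μ with ha
  -- Average the finite sums over `m` independent `μ`-distributed points: the `m` diagonal terms
  -- contribute `a` each, the `m (m - 1)` off-diagonal ones `b` each. For large `m` the latter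
  -- dominate, which forces `0 ≤ b`.
  have key : ∀ m : ℕ, 0 ≤ (m : ℝ) * a + m * (m - 1) * b := by
    intro m
    have hint : ∀ i j : Fin m, Integrable (fun x : Fin m → S => F (x i, x j))
        (Measure.pi fun _ => μ) := by
      intro i j
      by_cases hij : i = j
      · subst hij
        exact (measurePreserving_eval (fun _ : Fin m => μ) i).integrable_comp_of_integrable hd
      · exact (measurePreserving_eval_pair μ hij).integrable_comp_of_integrable hF
    have hval : ∀ i j : Fin m, ∫ x : Fin m → S, F (x i, x j) ∂(Measure.pi fun _ => μ) =
        if i = j then a else b := by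
      intro i j
      split_ifs with hij
      · subst hij
        have e := (measurePreserving_eval (fun _ : Fin m => μ) i)
        have h1 := integral_map (f := fun x => F (x, x)) e.measurable.aemeasurable
          (by rw [e.map_eq]; exact hd.aestronglyMeasurable)
        rw [e.map_eq] at h1
        exact h1.symm
      · have e := measurePreserving_eval_pair μ hij
        have h1 := integral_map (f := F) e.measurable.aemeasurable
          (by rw [e.map_eq]; exact hF.aestronglyMeasurable)
        rw [e.map_eq] at h1
        exact h1.symm
    have h0 : 0 ≤ ∫ x : Fin m → S, ∑ i, ∑ j, F (x i, x j) ∂(Measure.pi fun _ => μ) :=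
      integral_nonneg fun x => h m x
    rw [integral_finsetSum _ fun i _ => integrable_finsetSum _ fun j _ => hint i j] at h0
    simp_rw [integral_finsetSum _ fun j _ => hint _ j, hval] at h0
    have e : ∀ i : Fin m, ∑ j, (if i = j then a else b) = a + (m - 1) * b := by
      intro i
      have : ∀ j, (if i = j then a else b) = (if i = j then a - b else 0) + b := by
        intro j; split_ifs <;> ring
      simp only [this, Finset.sum_add_distrib, Finset.sum_ite_eq, Finset.mem_univ, if_true,
        Finset.sum_const, Finset.card_univ, Fintype.card_fin, nsmul_eq_mul]
      ring
    simp only [e, Finset.sum_const, Finset.card_univ, Fintype.card_fin, nsmul_eq_mul] at h0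
    linarith
  by_contra! hneg
  obtain ⟨m, hm⟩ := exists_nat_gt (a / (-b))
  rw [div_lt_iff₀ (by linarith)] at hm
  have := key (m + 1)
  push_cast at this
  have hm0 : (0 : ℝ) ≤ m := m.cast_nonneg
  nlinarith

end Integral

/-! ### Integrals of continuous functions on a compact space. -/

section Compact

variable {S : Type*} [TopologicalSpace S] [CompactSpace S] [MeasurableSpace S]
  [OpensMeasurableSpace S] {μ : Measure S} [IsFiniteMeasure μ]

theorem integrable_of_continuous {F : Type*} [NormedAddCommGroup F] {f : S → F}
    [SecondCountableTopologyEither S F] (hf : Continuous f) : Integrable f μ :=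
  hf.integrable_of_hasCompactSupport (HasCompactSupport.of_compactSpace f)

theorem integrable_norm_sq {f : S → ℂ} (hf : Continuous f) : Integrable (fun x => ‖f x‖ ^ 2) μ :=
  integrable_of_continuous (hf.norm.pow 2)

/-- Cauchy–Schwarz, from the discriminant of the nonnegative quadratic `t ↦ ∫ (t ‖f‖ + ‖g‖)²`. -/
theorem norm_integral_mul_sq_le {f g : S → ℂ} (hf : Continuous f) (hg : Continuous g) :
    ‖∫ x, f x * g x ∂μ‖ ^ 2 ≤ (∫ x, ‖f x‖ ^ 2 ∂μ) * ∫ x, ‖g x‖ ^ 2 ∂μ := by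
  have h1 : ‖∫ x, f x * g x ∂μ‖ ≤ ∫ x, ‖f x‖ * ‖g x‖ ∂μ := by
    refine (norm_integral_le_integral_norm _).trans_eq ?_
    simp_rw [norm_mul]
  have h2 : ∀ t : ℝ, 0 ≤ (∫ x, ‖f x‖ ^ 2 ∂μ) * (t * t) + (2 * ∫ x, ‖f x‖ * ‖g x‖ ∂μ) * t +
      ∫ x, ‖g x‖ ^ 2 ∂μ := by
    intro t
    have : ∫ x, (t * ‖f x‖ + ‖g x‖) ^ 2 ∂μ = (∫ x, ‖f x‖ ^ 2 ∂μ) * (t * t) +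
        (2 * ∫ x, ‖f x‖ * ‖g x‖ ∂μ) * t + ∫ x, ‖g x‖ ^ 2 ∂μ := by
      have e : ∀ x, (t * ‖f x‖ + ‖g x‖) ^ 2 =
          (t * t) * ‖f x‖ ^ 2 + (2 * t) * (‖f x‖ * ‖g x‖) + ‖g x‖ ^ 2 := fun x => by ring
      simp_rw [e]
      rw [integral_add (integrable_of_continuous (by fun_prop))
        (integrable_of_continuous (by fun_prop)),
        integral_add (integrable_of_continuous (by fun_prop))
        (integrable_of_continuous (by fun_prop)), integral_const_mul, integral_const_mul]
      ring
    rw [← this]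
    exact integral_nonneg fun x => sq_nonneg _
  have h3 := discrim_le_zero h2
  rw [discrim] at h3
  have h4 : ‖∫ x, f x * g x ∂μ‖ ^ 2 ≤ (∫ x, ‖f x‖ * ‖g x‖ ∂μ) ^ 2 :=
    pow_le_pow_left₀ (norm_nonneg _) h1 2
  nlinarith

end Compact

/-! ### Abstract Szegő kernels and the boundedness criterion. -/

section Szego

variable {E S : Type*} [NormedAddCommGroup E] [NormedSpace ℂ E] [TopologicalSpace S]
  [MeasurableSpace S]

/-- The Hardy norm of functions on a domain whose distinguished boundary is parametrized by
`ι : S → E`. -/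
def hardyNorm (μ : Measure S) (ι : S → E) (f : E → ℂ) : ℝ≥0∞ :=
  (⨆ r ∈ Set.Ico (0 : ℝ) 1, ∫⁻ ζ, ‖f ((r : ℂ) • ι ζ)‖ₑ ^ 2 ∂μ) ^ (1 / 2 : ℝ)

/-- `k` is a Szegő kernel of the domain `D` with respect to the measure `μ` on a distinguished
boundary, parametrized by `ι`. -/
structure IsSzegoKernel (D : Set E) (μ : Measure S) (ι : S → E) (k : E → E → ℂ) : Prop where
  isOpen : IsOpen D
  smul_boundary_mem : ∀ r ∈ Set.Ico (0 : ℝ) 1, ∀ ζ, (r : ℂ) • ι ζ ∈ D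
  exists_inv_smul_mem : ∀ z ∈ D, ∃ ρ ∈ Set.Ioo (0 : ℝ) 1, ((ρ⁻¹ : ℝ) : ℂ) • z ∈ D
  continuous_boundary : Continuous ι
  conj_apply : ∀ z w, conj (k z w) = k w z
  apply_smul : ∀ (r : ℝ) z w, k ((r : ℂ) • z) w = k z ((r : ℂ) • w)
  apply_ne_zero : ∀ z ∈ D, ∀ w ∈ D, k z w ≠ 0
  bounded : ∀ w ∈ D, ∃ M : ℝ, ∀ z ∈ D, ‖k z w‖ ≤ M
  differentiableOn : ∀ w ∈ D, DifferentiableOn ℂ (fun z => k z w) D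
  continuousOn : ContinuousOn (fun p : E × E => k p.1 p.2) (D ×ˢ D)
  reproducing : ∀ g : E → ℂ, DifferentiableOn ℂ g D → ∀ r ∈ Set.Ico (0 : ℝ) 1, ∀ z ∈ D,
    ∫ ζ, g ((r : ℂ) • ι ζ) * k z (ι ζ) ∂μ = g ((r : ℂ) • z)

namespace IsSzegoKernel

variable {D : Set E} {μ : Measure S} {ι : S → E} {k : E → E → ℂ} (hk : IsSzegoKernel D μ ι k)
include hk

theorem continuous_dilate {g : E → ℂ} (hg : ContinuousOn g D) {r : ℝ} (hr : r ∈ Set.Ico (0 : ℝ) 1) :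
    Continuous fun ζ => g ((r : ℂ) • ι ζ) :=
  hg.comp_continuous (hk.continuous_boundary.const_smul _) (hk.smul_boundary_mem r hr)

/-- Continuity of `k` is only assumed inside `D × D`. Moving a factor `ρ` from `z` to the boundary
point, `k z ζ = k (z/ρ) (ρ ζ)`, brings both arguments into `D`. -/
theorem continuous_boundary_apply {z : E} (hz : z ∈ D) : Continuous fun ζ => k z (ι ζ) := by
  obtain ⟨ρ, hρ, hz'⟩ := hk.exists_inv_smul_mem z hz
  have e : ∀ ζ, k z (ι ζ) = k (((ρ⁻¹ : ℝ) : ℂ) • z) ((ρ : ℂ) • ι ζ) := by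
    intro ζ
    rw [← hk.apply_smul, smul_smul, ← Complex.ofReal_mul, mul_inv_cancel₀ hρ.1.ne',
      Complex.ofReal_one, one_smul]
  simp_rw [e]
  exact hk.continuousOn.comp_continuous
    (f := fun ζ => ((((ρ⁻¹ : ℝ) : ℂ) • z, (ρ : ℂ) • ι ζ) : E × E))
    (continuous_const.prodMk (hk.continuous_boundary.const_smul _))
    fun ζ => ⟨hz', hk.smul_boundary_mem ρ ⟨hρ.1.le, hρ.2⟩ ζ⟩

/-- The reproducing formula needs a dilated function, and `k(·, w)` is the `ρ`-dilate of `k(·,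
w/ρ)`, which is holomorphic on `D`. -/
theorem integral_apply_mul_apply {z w : E} (hz : z ∈ D) (hw : w ∈ D) :
    ∫ ζ, k (ι ζ) w * k z (ι ζ) ∂μ = k z w := by
  obtain ⟨ρ, hρ, hw'⟩ := hk.exists_inv_smul_mem w hw
  have h := hk.reproducing _ (hk.differentiableOn _ hw') ρ ⟨hρ.1.le, hρ.2⟩ z hz
  have e : ∀ u, k ((ρ : ℂ) • u) (((ρ⁻¹ : ℝ) : ℂ) • w) = k u w := by
    intro u
    rw [hk.apply_smul, smul_smul, ← Complex.ofReal_mul, mul_inv_cancel₀ hρ.1.ne',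
      Complex.ofReal_one, one_smul]
  simpa only [e] using h

variable [CompactSpace S] [BorelSpace S] [IsProbabilityMeasure μ]

theorem hardyNorm_le_iff {f : E → ℂ} (hf : ContinuousOn f D) {N : ℝ} (hN : 0 ≤ N) :
    hardyNorm μ ι f ≤ ENNReal.ofReal N ↔
      ∀ r ∈ Set.Ico (0 : ℝ) 1, ∫ ζ, ‖f ((r : ℂ) • ι ζ)‖ ^ 2 ∂μ ≤ N ^ 2 := by
  have e : ENNReal.ofReal N = ENNReal.ofReal (N ^ 2) ^ (1 / 2 : ℝ) := by
    rw [ENNReal.ofReal_rpow_of_nonneg (by positivity) (by norm_num), ← Real.sqrt_eq_rpow,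
      Real.sqrt_sq hN]
  rw [hardyNorm, e, ENNReal.rpow_le_rpow_iff (by norm_num), iSup₂_le_iff]
  refine forall₂_congr fun r hr => ?_
  have e2 : ∫⁻ ζ, ‖f ((r : ℂ) • ι ζ)‖ₑ ^ 2 ∂μ =
      ENNReal.ofReal (∫ ζ, ‖f ((r : ℂ) • ι ζ)‖ ^ 2 ∂μ) := by
    rw [ofReal_integral_eq_lintegral_ofReal
      (integrable_norm_sq (hk.continuous_dilate hf hr))
      (Filter.Eventually.of_forall fun _ => sq_nonneg _)]
    refine lintegral_congr fun ζ => ?_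
    rw [ENNReal.ofReal_pow (norm_nonneg _), ofReal_norm]
  rw [e2, ENNReal.ofReal_le_ofReal_iff (by positivity)]

theorem hardyNorm_le_mul {f h : E → ℂ} (hf : ContinuousOn f D) (hh : ContinuousOn h D) {M N : ℝ}
    (hM : 0 ≤ M) (hN : 0 ≤ N) (hle : ∀ z ∈ D, ‖f z‖ ≤ M * ‖h z‖)
    (hhN : hardyNorm μ ι h ≤ ENNReal.ofReal N) : hardyNorm μ ι f ≤ ENNReal.ofReal (M * N) := by
  rw [hk.hardyNorm_le_iff hf (by positivity)]
  rw [hk.hardyNorm_le_iff hh hN] at hhN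
  intro r hr
  calc ∫ ζ, ‖f ((r : ℂ) • ι ζ)‖ ^ 2 ∂μ ≤ ∫ ζ, M ^ 2 * ‖h ((r : ℂ) • ι ζ)‖ ^ 2 ∂μ := by
        refine integral_mono (integrable_of_continuous ((hk.continuous_dilate hf hr).norm.pow 2))
          (integrable_of_continuous (((hk.continuous_dilate hh hr).norm.pow 2).const_mul _))
          fun ζ => ?_
        have := pow_le_pow_left₀ (norm_nonneg _) (hle _ (hk.smul_boundary_mem r hr ζ)) 2
        simpa only [mul_pow] using this
    _ = M ^ 2 * ∫ ζ, ‖h ((r : ℂ) • ι ζ)‖ ^ 2 ∂μ := integral_const_mul _ _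
    _ ≤ M ^ 2 * N ^ 2 := by gcongr; exact hhN r hr
    _ = (M * N) ^ 2 := by ring

/-- A function in the Hardy space of norm at most `N` is dominated by `N ^ 2` times the Szegő
kernel. -/
theorem isKernelOn_sub {f : E → ℂ} (hf : DifferentiableOn ℂ f D) {N : ℝ} (hN : 0 ≤ N)
    (hfN : hardyNorm μ ι f ≤ ENNReal.ofReal N) :
    IsKernelOn D fun z w => (N : ℂ) ^ 2 * k z w - f z * conj (f w) := by
  rw [hk.hardyNorm_le_iff hf.continuousOn hN] at hfN
  refine isKernelOn_iff.2 ⟨fun z _ w _ => ?_, fun m x hx c => ?_⟩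
  · simp only [map_sub, map_mul, map_pow, Complex.conj_ofReal, hk.conj_apply, Complex.conj_conj]
    ring
  -- `conj q` is the boundary function of `∑ c j k(·, x j)`. Its squared norm `Q` is the quadratic
  -- form of `k`, and integrating `f` against `q` evaluates `f` at the points `x i`.
  set q : S → ℂ := fun ζ => ∑ i, conj (c i) * k (x i) (ι ζ) with hq
  have hqc : Continuous q := continuous_finsetSum _ fun i _ =>
    continuous_const.mul (hk.continuous_boundary_apply (hx i))
  set Q : ℝ := ∫ ζ, ‖q ζ‖ ^ 2 ∂μ with hQ
  have hQ' : ∑ i, ∑ j, conj (c i) * k (x i) (x j) * c j = (Q : ℂ) := by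
    rw [hQ, ← integral_complex_ofReal]
    have e : ∀ ζ, ((‖q ζ‖ ^ 2 : ℝ) : ℂ) =
        ∑ i, ∑ j, (conj (c i) * c j) * (k (ι ζ) (x j) * k (x i) (ι ζ)) := by
      intro ζ
      rw [Complex.ofReal_pow, ← Complex.mul_conj', hq, map_sum, Finset.sum_mul_sum]
      refine Finset.sum_congr rfl fun i _ => Finset.sum_congr rfl fun j _ => ?_
      rw [map_mul, hk.conj_apply, Complex.conj_conj]
      ring
    have hc : ∀ i j, Continuous fun ζ => (conj (c i) * c j) * (k (ι ζ) (x j) * k (x i) (ι ζ)) := by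
      intro i j
      refine continuous_const.mul (Continuous.mul ?_ (hk.continuous_boundary_apply (hx i)))
      simp_rw [← hk.conj_apply (x j)]
      exact Complex.continuous_conj.comp (hk.continuous_boundary_apply (hx j))
    simp_rw [e]
    rw [integral_finsetSum _ fun i _ => integrable_finsetSum _ fun j _ =>
      integrable_of_continuous (hc i j)]
    refine Finset.sum_congr rfl fun i _ => ?_
    rw [integral_finsetSum _ fun j _ => integrable_of_continuous (hc i j)]
    refine Finset.sum_congr rfl fun j _ => ?_
    rw [integral_const_mul, hk.integral_apply_mul_apply (hx i) (hx j)]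
    ring
  set s : ℂ := ∑ i, conj (c i) * f (x i) with hs
  have hle : ‖s‖ ^ 2 ≤ N ^ 2 * Q := by
    -- Boundary values of `f` are not available, so Cauchy–Schwarz is applied to the dilate of `f`
    -- by `r < 1`, and then `r → 1`.
    have ht : Filter.Tendsto (fun r : ℝ => ‖∑ i, conj (c i) * f ((r : ℂ) • x i)‖ ^ 2)
        (nhdsWithin 1 (Set.Iio 1)) (nhds (‖s‖ ^ 2)) := by
      refine ((tendsto_finsetSum _ fun i _ => Filter.Tendsto.const_mul _ ?_).norm).pow 2
      have h1 : ContinuousAt f (x i) := (hf.continuousOn).continuousAt (hk.isOpen.mem_nhds (hx i))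
      have h2 : Filter.Tendsto (fun r : ℝ => (r : ℂ) • x i) (nhdsWithin 1 (Set.Iio 1))
          (nhds (x i)) := by
        have : Continuous fun r : ℝ => (r : ℂ) • x i := by fun_prop
        have := (this.tendsto 1).mono_left (nhdsWithin_le_nhds (s := Set.Iio 1))
        simpa using this
      exact h1.tendsto.comp h2
    refine le_of_tendsto ht ?_
    have : Set.Ioo (0 : ℝ) 1 ∈ nhdsWithin (1 : ℝ) (Set.Iio 1) := Ioo_mem_nhdsLT (by norm_num)
    filter_upwards [this] with r hr
    have hr' : r ∈ Set.Ico (0 : ℝ) 1 := ⟨hr.1.le, hr.2⟩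
    have hfc := hk.continuous_dilate hf.continuousOn hr'
    have e : ∑ i, conj (c i) * f ((r : ℂ) • x i) = ∫ ζ, f ((r : ℂ) • ι ζ) * q ζ ∂μ := by
      simp_rw [hq, Finset.mul_sum]
      have hic : ∀ i, Continuous fun ζ => f ((r : ℂ) • ι ζ) * (conj (c i) * k (x i) (ι ζ)) :=
        fun i => hfc.mul (continuous_const.mul (hk.continuous_boundary_apply (hx i)))
      rw [integral_finsetSum _ fun i _ => integrable_of_continuous (hic i)]
      refine Finset.sum_congr rfl fun i _ => ?_
      simp_rw [mul_left_comm _ (conj (c i))]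
      rw [integral_const_mul, hk.reproducing f hf r hr' _ (hx i)]
    rw [e]
    refine (norm_integral_mul_sq_le hfc hqc).trans ?_
    exact mul_le_mul_of_nonneg_right (hfN r hr') (integral_nonneg fun ζ => sq_nonneg ‖q ζ‖)
  have e : ∑ i, ∑ j, conj (c i) * ((N : ℂ) ^ 2 * k (x i) (x j) - f (x i) * conj (f (x j))) * c j =
      ((N ^ 2 * Q - ‖s‖ ^ 2 : ℝ) : ℂ) := by
    push_cast
    rw [← hQ', ← Complex.mul_conj', hs, map_sum, Finset.sum_mul_sum, Finset.mul_sum,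
      ← Finset.sum_sub_distrib]
    refine Finset.sum_congr rfl fun i _ => ?_
    rw [Finset.mul_sum, ← Finset.sum_sub_distrib]
    refine Finset.sum_congr rfl fun j _ => ?_
    rw [map_mul, Complex.conj_conj]
    ring
  rw [e, Complex.zero_le_real]
  linarith

theorem isKernelOn : IsKernelOn D k := by
  have h0 : hardyNorm μ ι (fun _ : E => (0 : ℂ)) ≤ ENNReal.ofReal 1 := by
    rw [hk.hardyNorm_le_iff continuousOn_const zero_le_one]
    intro r _
    simp
  exact (hk.isKernelOn_sub (differentiableOn_const 0) zero_le_one h0).congr fun z _ w _ => by simp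

theorem apply_self_pos {z : E} (hz : z ∈ D) : 0 < k z z := by
  have h := hk.isKernelOn 1 (fun _ => z) fun _ => hz
  exact lt_of_le_of_ne (h.diag_nonneg (i := 0)) (hk.apply_ne_zero z hz z hz).symm

variable [SecondCountableTopology S]

/-- Test the kernel against `u(ζ) = h(r ζ)` itself. The rank-one term gives the square of `∫ ‖u‖²`.
In the other term, `k(r ζ, r η) = k(r² ζ, η)`, so reproducing `h(r ·)` at `r² ζ` yields `h(r³ ζ)`;
this is the source of the cube. The arithmetic–geometric mean inequality bounds the resulting
pairing. -/
theorem sq_integral_le_of_isKernelOn {h : E → ℂ} (hh : DifferentiableOn ℂ h D) {N : ℝ}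
    (hK : IsKernelOn D fun z w => (N : ℂ) ^ 2 * k z w - h z * conj (h w)) {r : ℝ}
    (hr : r ∈ Set.Ico (0 : ℝ) 1) :
    (∫ ζ, ‖h ((r : ℂ) • ι ζ)‖ ^ 2 ∂μ) ^ 2 ≤ N ^ 2 *
      ((∫ ζ, ‖h ((r : ℂ) • ι ζ)‖ ^ 2 ∂μ) + ∫ ζ, ‖h (((r ^ 3 : ℝ) : ℂ) • ι ζ)‖ ^ 2 ∂μ) / 2 := by
  have hr2 : r ^ 2 ∈ Set.Ico (0 : ℝ) 1 := ⟨sq_nonneg r, pow_lt_one₀ hr.1 hr.2 two_ne_zero⟩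
  have hr3 : r ^ 3 ∈ Set.Ico (0 : ℝ) 1 := ⟨pow_nonneg hr.1 3, pow_lt_one₀ hr.1 hr.2 three_ne_zero⟩
  have hc := hk.continuous_dilate hh.continuousOn hr
  have hc3 := hk.continuous_dilate hh.continuousOn hr3
  set u : S → ℂ := fun ζ => h ((r : ℂ) • ι ζ) with hu
  set v : S → ℂ := fun ζ => h (((r ^ 3 : ℝ) : ℂ) • ι ζ) with hv
  set A := ∫ ζ, ‖u ζ‖ ^ 2 ∂μ with hA
  set G : S × S → ℂ := fun p => conj (u p.1) * k ((r : ℂ) • ι p.1) ((r : ℂ) • ι p.2) * u p.2 with hG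
  have hGc : Continuous G := by
    refine ((Complex.continuous_conj.comp (hc.comp continuous_fst)).mul ?_).mul
      (hc.comp continuous_snd)
    refine hk.continuousOn.comp_continuous
      (f := fun p : S × S => (((r : ℂ) • ι p.1, (r : ℂ) • ι p.2) : E × E)) ?_
      fun p => ⟨hk.smul_boundary_mem r hr _, hk.smul_boundary_mem r hr _⟩
    have := hk.continuous_boundary
    fun_prop
  set F : S × S → ℝ := fun p => N ^ 2 * (G p).re - ‖u p.1‖ ^ 2 * ‖u p.2‖ ^ 2 with hF
  have hFc : Continuous F := by
    have := Complex.continuous_re.comp hGc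
    have h1 := hc.comp (continuous_fst (X := S) (Y := S))
    have h2 := hc.comp (continuous_snd (X := S) (Y := S))
    exact (continuous_const.mul this).sub ((h1.norm.pow 2).mul (h2.norm.pow 2))
  have hpos : 0 ≤ ∫ p, F p ∂(μ.prod μ) := by
    refine integral_prod_nonneg_of_sum_nonneg μ (integrable_of_continuous hFc)
      (integrable_of_continuous (hFc.comp (continuous_id.prodMk continuous_id))) fun m x => ?_
    have h1 := (isKernelOn_iff.1 hK).2 m (fun i => (r : ℂ) • ι (x i))
      (fun i => hk.smul_boundary_mem r hr _) fun i => u (x i)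
    have h2 := (Complex.le_def.1 h1).1
    simp only [Complex.re_sum, Complex.zero_re] at h2
    convert h2 using 4 with i _ j _
    have e : conj (u (x i)) * ((N : ℂ) ^ 2 * k ((r : ℂ) • ι (x i)) ((r : ℂ) • ι (x j)) -
        h ((r : ℂ) • ι (x i)) * conj (h ((r : ℂ) • ι (x j)))) * u (x j) =
        ((N ^ 2 : ℝ) : ℂ) * G (x i, x j) - ((‖u (x i)‖ ^ 2 * ‖u (x j)‖ ^ 2 : ℝ) : ℂ) := by
      push_cast
      rw [← Complex.mul_conj', ← Complex.mul_conj']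
      simp only [hG, hu]
      ring
    rw [e, Complex.sub_re, Complex.re_ofReal_mul, Complex.ofReal_re]
  have hint : ∫ p, G p ∂(μ.prod μ) = ∫ ζ, conj (u ζ) * v ζ ∂μ := by
    rw [integral_prod _ (integrable_of_continuous hGc)]
    refine integral_congr_ae (Filter.Eventually.of_forall fun ζ => ?_)
    have h1 := hk.reproducing h hh r hr _ (hk.smul_boundary_mem _ hr2 ζ)
    have e : ∀ η, G (ζ, η) =
        conj (u ζ) * (h ((r : ℂ) • ι η) * k (((r ^ 2 : ℝ) : ℂ) • ι ζ) (ι η)) := by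
      intro η
      simp only [hG, hu]
      rw [← hk.apply_smul, smul_smul, ← Complex.ofReal_mul, ← sq]
      ring
    simp only [e]
    rw [integral_const_mul, h1, smul_smul, ← Complex.ofReal_mul]
    congr 4
    ring
  have hval : ∫ p, F p ∂(μ.prod μ) = N ^ 2 * (∫ ζ, conj (u ζ) * v ζ ∂μ).re - A ^ 2 := by
    rw [hF, integral_sub, integral_const_mul, integral_prod_mul (fun ζ => ‖u ζ‖ ^ 2)
      (fun ζ => ‖u ζ‖ ^ 2), ← hint, sq A]
    · congr 2
      exact integral_re (𝕜 := ℂ) (integrable_of_continuous hGc)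
    · exact integrable_of_continuous (continuous_const.mul (Complex.continuous_re.comp hGc))
    · have h1 := hc.comp (continuous_fst (X := S) (Y := S))
      have h2 := hc.comp (continuous_snd (X := S) (Y := S))
      exact integrable_of_continuous ((h1.norm.pow 2).mul (h2.norm.pow 2))
  have hre : (∫ ζ, conj (u ζ) * v ζ ∂μ).re ≤ (A + ∫ ζ, ‖v ζ‖ ^ 2 ∂μ) / 2 := by
    refine (Complex.re_le_norm _).trans ((norm_integral_le_integral_norm _).trans ?_)
    rw [hA, ← integral_add (integrable_norm_sq hc) (integrable_norm_sq hc3), ← integral_div]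
    refine integral_mono (integrable_of_continuous
      ((Complex.continuous_conj.comp hc).mul hc3).norm)
      (integrable_of_continuous (((hc.norm.pow 2).add (hc3.norm.pow 2)).div_const _)) fun ζ => ?_
    simp only [norm_mul, RCLike.norm_conj]
    nlinarith [sq_nonneg (‖u ζ‖ - ‖v ζ‖)]
  rw [hval] at hpos
  nlinarith [mul_le_mul_of_nonneg_left hre (sq_nonneg N)]

/-- A holomorphic function dominated by `N ^ 2` times the Szegő kernel is in the Hardy space, with
norm at most `N`. -/
theorem hardyNorm_le_of_isKernelOn {h : E → ℂ} (hh : DifferentiableOn ℂ h D) {N : ℝ} (hN : 0 ≤ N)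
    (hK : IsKernelOn D fun z w => (N : ℂ) ^ 2 * k z w - h z * conj (h w)) :
    hardyNorm μ ι h ≤ ENNReal.ofReal N := by
  rw [hk.hardyNorm_le_iff hh.continuousOn hN]
  intro r hr
  set A : ℝ → ℝ := fun s => ∫ ζ, ‖h ((s : ℂ) • ι ζ)‖ ^ 2 ∂μ with hA
  have hsub : ∀ s ∈ Set.Icc 0 r, s ∈ Set.Ico (0 : ℝ) 1 := fun s hs => ⟨hs.1, hs.2.trans_lt hr.2⟩
  obtain ⟨B, hB⟩ : ∃ B, ∀ s ∈ Set.Icc 0 r, ∀ ζ, ‖h ((s : ℂ) • ι ζ)‖ ≤ B := by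
    have hcp : IsCompact (Set.Icc (0 : ℝ) r ×ˢ (Set.univ : Set S)) := isCompact_Icc.prod isCompact_univ
    have hct : ContinuousOn (fun p : ℝ × S => h ((p.1 : ℂ) • ι p.2))
        (Set.Icc (0 : ℝ) r ×ˢ (Set.univ : Set S)) := by
      refine hh.continuousOn.comp (t := D) (Continuous.continuousOn ?_)
        fun p hp => hk.smul_boundary_mem _ (hsub _ hp.1) _
      have := hk.continuous_boundary
      fun_prop
    obtain ⟨B, hB⟩ := hcp.exists_bound_of_continuousOn hct
    exact ⟨B, fun s hs ζ => hB (s, ζ) ⟨hs, trivial⟩⟩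
  have hAB : BddAbove (A '' Set.Icc 0 r) := by
    refine ⟨B ^ 2, ?_⟩
    rintro _ ⟨s, hs, rfl⟩
    calc A s ≤ ∫ _ : S, B ^ 2 ∂μ := by
          refine integral_mono (integrable_of_continuous
            ((hk.continuous_dilate hh.continuousOn (hsub s hs)).norm.pow 2)) (integrable_const _)
            fun ζ => pow_le_pow_left₀ (norm_nonneg _) (hB s hs ζ) 2
      _ = B ^ 2 := by simp
  -- The bound for `A s` involves `A (s ^ 3)`. Since `[0, r]` is stable under cubing, passing to the
  -- supremum closes the estimate: `M² ≤ N² M`, hence `M ≤ N²`, without knowing that `A` is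
  -- monotone.
  set M := sSup (A '' Set.Icc 0 r) with hM
  have hAM : ∀ s ∈ Set.Icc 0 r, A s ≤ M := fun s hs => le_csSup hAB ⟨s, hs, rfl⟩
  have hA0 : ∀ s, 0 ≤ A s := fun s => integral_nonneg fun _ => by positivity
  have hrr : r ∈ Set.Icc 0 r := ⟨hr.1, le_rfl⟩
  have hM0 : 0 ≤ M := (hA0 r).trans (hAM r hrr)
  have hsq : ∀ s ∈ Set.Icc 0 r, A s ^ 2 ≤ N ^ 2 * M := by
    intro s hs
    have h1 := hk.sq_integral_le_of_isKernelOn hh hK (hsub s hs)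
    have hs3 : s ^ 3 ∈ Set.Icc 0 r := by
      refine ⟨pow_nonneg hs.1 3, le_trans ?_ hs.2⟩
      have := pow_le_one₀ (n := 2) hs.1 (hsub s hs).2.le
      nlinarith [hs.1]
    refine h1.trans ?_
    have h2 := hAM s hs
    have h3 := hAM _ hs3
    have : N ^ 2 * (A s + A (s ^ 3)) ≤ N ^ 2 * (M + M) :=
      mul_le_mul_of_nonneg_left (add_le_add h2 h3) (sq_nonneg N)
    simp only [hA] at this ⊢
    linarith
  have hMM : M ≤ √(N ^ 2 * M) := by
    refine csSup_le ⟨_, r, hrr, rfl⟩ ?_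
    rintro _ ⟨s, hs, rfl⟩
    exact Real.le_sqrt_of_sq_le (hsq s hs)
  have hMM2 : M ^ 2 ≤ N ^ 2 * M := by
    have := pow_le_pow_left₀ hM0 hMM 2
    rwa [Real.sq_sqrt (by positivity)] at this
  refine (hAM r hrr).trans ?_
  rcases hM0.eq_or_lt with h0 | h0
  · rw [← h0]; positivity
  · nlinarith

/-- If the quotient of the Szegő kernel by its pullback along a self-map is a kernel, then the
composition operator is bounded on the Hardy space. -/
theorem boundedComp {φ : E → E} (hφ : IsHolSelfMap D φ)
    (hK : IsKernelOn D fun z w => k z w / k (φ z) (φ w)) :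
    BoundedComp {f | DifferentiableOn ℂ f D ∧ hardyNorm μ ι f < ∞} (hardyNorm μ ι) φ := by
  have : Nonempty S := by
    by_contra h
    rw [not_nonempty_iff] at h
    have := measure_univ (μ := μ)
    rw [Set.eq_empty_of_isEmpty (Set.univ : Set S), measure_empty] at this
    exact zero_ne_one this
  have h0 : (0 : E) ∈ D := by
    simpa using hk.smul_boundary_mem 0 ⟨le_rfl, one_pos⟩ (Classical.arbitrary S)
  set a := φ 0 with ha
  have haD : a ∈ D := hφ.2 h0
  -- Homogeneity with dilation factor `0`.
  have hk0 : ∀ z, k z 0 = k 0 0 := by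
    intro z
    have := hk.apply_smul 0 z 0
    simpa using this.symm
  have hk0' : ∀ z, k 0 z = k 0 0 := by
    intro z
    rw [← hk.conj_apply, hk0, hk.conj_apply]
  obtain ⟨b, hb, hkb⟩ : ∃ b : ℝ, 0 < b ∧ k 0 0 = b :=
    (RCLike.pos_iff_exists_ofReal.1 (hk.apply_self_pos h0)).imp fun _ h => ⟨h.1, h.2.symm⟩
  obtain ⟨d, hd, hkd⟩ : ∃ d : ℝ, 0 < d ∧ k a a = d :=
    (RCLike.pos_iff_exists_ofReal.1 (hk.apply_self_pos haD)).imp fun _ h => ⟨h.1, h.2.symm⟩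
  have hb' : (b : ℂ) ≠ 0 := by exact_mod_cast hb.ne'
  have hd' : (d : ℂ) ≠ 0 := by exact_mod_cast hd.ne'
  set g : E → ℂ := fun z => (k (φ z) a)⁻¹ with hg
  have hne : ∀ z ∈ D, k (φ z) a ≠ 0 := fun z hz => hk.apply_ne_zero _ (hφ.2 hz) _ haD
  have hgd : DifferentiableOn ℂ g D :=
    ((hk.differentiableOn a haD).comp hφ.1 hφ.2).inv hne
  -- Schur complement of the quotient kernel at `0`, multiplied by the pulled back kernel `k (φ z)
  -- (φ w)` to clear the denominator.
  have hP : IsKernelOn D fun z w =>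
      k z w - (b * d : ℂ) * (g z * conj (g w)) * k (φ z) (φ w) := by
    have h1 := hK.schur_complement h0 (by
      rw [← ha, hkb, hkd, ← Complex.ofReal_div, Complex.zero_lt_real]
      positivity)
    refine (h1.mul (hk.isKernelOn.comp hφ.2)).congr fun z hz w hw => ?_
    have hzw := hk.apply_ne_zero _ (hφ.2 hz) _ (hφ.2 hw)
    have hza := hne z hz
    have haw := hk.apply_ne_zero _ haD _ (hφ.2 hw)
    simp only [← ha, hk0, hk0', hkb, hkd, hg, map_inv₀, hk.conj_apply]
    field_simp
  obtain ⟨M, hM⟩ := hk.bounded a haD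
  have hM0 : 0 ≤ M := (norm_nonneg _).trans (hM 0 h0)
  have hbd : 0 < b * d := mul_pos hb hd
  refine ⟨(M / √(b * d)).toNNReal, fun f hf => ?_⟩
  have hfφ : DifferentiableOn ℂ (f ∘ φ) D := hf.1.comp hφ.1 hφ.2
  have hhd : DifferentiableOn ℂ (fun z => g z * f (φ z)) D := hgd.mul hfφ
  set N := (hardyNorm μ ι f).toReal with hNdef
  have hN : hardyNorm μ ι f = ENNReal.ofReal N := (ENNReal.ofReal_toReal hf.2.ne).symm
  have hN0 : 0 ≤ N := ENNReal.toReal_nonneg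
  have h1 := hk.isKernelOn_sub hf.1 hN0 hN.le
  have h2 : IsKernelOn D fun z w => ((N / √(b * d) : ℝ) : ℂ) ^ 2 * k z w -
      (g z * f (φ z)) * conj (g w * f (φ w)) := by
    -- Sum of two kernels: the criterion for `f` pulled back along `φ` and weighted by `g(z)
    -- conj(g(w))`, and `N² / (b d)` times `hP`. The terms containing `k (φ z) (φ w)` cancel.
    refine (((isKernelOn_mul_conj D g).mul (h1.comp hφ.2)).add
      ((isKernelOn_const D (a := N ^ 2 / (b * d)) (by positivity)).mul hP)).congr
      fun z _ w _ => ?_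
    have e : ((N / √(b * d) : ℝ) : ℂ) ^ 2 = (N : ℂ) ^ 2 / (b * d) := by
      rw [← Complex.ofReal_pow, div_pow, Real.sq_sqrt hbd.le]
      push_cast
      rfl
    rw [e, map_mul]
    push_cast
    field_simp
    ring
  have h3 := hk.hardyNorm_le_of_isKernelOn hhd (by positivity) h2
  have h4 : hardyNorm μ ι (f ∘ φ) ≤ ENNReal.ofReal (M * (N / √(b * d))) := by
    refine hk.hardyNorm_le_mul hfφ.continuousOn hhd.continuousOn hM0 (by positivity)
      (fun z hz => ?_) h3
    have e : f (φ z) = k (φ z) a * (g z * f (φ z)) := by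
      simp only [hg]
      rw [mul_inv_cancel_left₀ (hne z hz)]
    calc ‖f (φ z)‖ = ‖k (φ z) a‖ * ‖g z * f (φ z)‖ := by rw [← norm_mul, ← e]
      _ ≤ _ := by gcongr; exact hM _ (hφ.2 hz)
  refine ⟨⟨hfφ, h4.trans_lt ENNReal.ofReal_lt_top⟩, h4.trans_eq ?_⟩
  rw [hN, ← ENNReal.ofReal_coe_nnreal, Real.coe_toNNReal _ (by positivity),
    ← ENNReal.ofReal_mul (by positivity)]
  congr 1
  ring

end IsSzegoKernel

end Szego

/-! ### Reproducing kernels from orthogonality of powers. -/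

section PowerSeries

variable {S : Type*} [TopologicalSpace S] [CompactSpace S] [MeasurableSpace S]
  [BorelSpace S] {μ : Measure S} [IsProbabilityMeasure μ]

theorem hasSum_integral_of_norm_le {F : ℕ → S → ℂ} {f : S → ℂ} {b : ℕ → ℝ}
    (hF : ∀ i, Continuous (F i)) (hb : Summable b) (hle : ∀ i x, ‖F i x‖ ≤ b i)
    (hf : ∀ x, HasSum (fun i => F i x) (f x)) :
    HasSum (fun i => ∫ x, F i x ∂μ) (∫ x, f x ∂μ) :=
  hasSum_integral_of_dominated_convergence (fun i _ => b i)
    (fun i => (integrable_of_continuous (hF i)).aestronglyMeasurable)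
    (fun i => Filter.Eventually.of_forall (hle i)) (Filter.Eventually.of_forall fun _ => hb)
    (integrable_const _) (Filter.Eventually.of_forall hf)

theorem exists_hasSum_of_differentiableOn_ball {G : ℂ → ℂ}
    (hG : DifferentiableOn ℂ G (Metric.ball 0 1)) :
    ∃ a : ℕ → ℂ, (∀ w, ‖w‖ < 1 → HasSum (fun j => a j * w ^ j) (G w)) ∧
      ∀ r : ℝ, 0 ≤ r → r < 1 → Summable fun j => ‖a j‖ * r ^ j := by
  have key : ∀ w : ℂ, ‖w‖ < 1 →
      HasSum (fun j => ((j.factorial : ℂ)⁻¹ * iteratedDeriv j G 0) * w ^ j) (G w) := by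
    intro w hw
    have := Complex.hasSum_taylorSeries_on_ball (r := 1) (c := 0) (f := G) (by simpa using hG)
      (z := w) (by simpa using hw)
    simpa [mul_comm, mul_left_comm, mul_assoc] using this
  refine ⟨_, key, fun r h0 h1 => ?_⟩
  have h := (key (r : ℂ) (by simpa [abs_of_nonneg h0] using h1)).summable.norm
  simpa [abs_of_nonneg h0] using h

/-- If the powers of a function `u` are orthogonal, then the kernel whose Taylor coefficients are
the inverses of their square norms is reproducing for holomorphic functions of `u`. -/
theorem integral_comp_mul_kernel_eq {u : S → ℂ} (hu : Continuous u) (hu1 : ∀ x, ‖u x‖ ≤ 1)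
    (horth : ∀ j k : ℕ, j ≠ k → ∫ x, u x ^ j * conj (u x) ^ k ∂μ = 0) {c : ℕ → ℂ}
    (hc : ∀ k, c k * ∫ x, u x ^ k * conj (u x) ^ k ∂μ = 1) {κ : ℂ → ℂ}
    (hκ : ∀ w, ‖w‖ < 1 → HasSum (fun k => c k * w ^ k) (κ w)) {G : ℂ → ℂ}
    (hG : DifferentiableOn ℂ G (Metric.ball 0 1)) {r : ℝ} (hr : r ∈ Set.Ico (0 : ℝ) 1) {z : ℂ}
    (hz : ‖z‖ < 1) :
    ∫ x, G (r * u x) * κ (z * conj (u x)) ∂μ = G (r * z) := by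
  obtain ⟨a, ha, has⟩ := exists_hasSum_of_differentiableOn_ball hG
  have hru : ∀ x, ‖(r : ℂ) * u x‖ ≤ r := by
    intro x
    rw [norm_mul, Complex.norm_real, Real.norm_of_nonneg hr.1]
    exact mul_le_of_le_one_right hr.1 (hu1 x)
  have hGc : Continuous fun x => G (r * u x) :=
    hG.continuousOn.comp_continuous (continuous_const.mul hu)
      fun x => by simpa using (hru x).trans_lt hr.2
  obtain ⟨B, hB⟩ : ∃ B, ∀ x, ‖G (r * u x)‖ ≤ B := by
    obtain ⟨B, hB⟩ := isCompact_univ.exists_bound_of_continuousOn hGc.continuousOn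
    exact ⟨B, fun x => hB x trivial⟩
  -- Integrating the Taylor series of `G` term by term against `conj u ^ k` leaves only the term of
  -- degree `k`.
  have step : ∀ k, ∫ x, G (r * u x) * conj (u x) ^ k ∂μ =
      a k * r ^ k * ∫ x, u x ^ k * conj (u x) ^ k ∂μ := by
    intro k
    have h1 : HasSum (fun j => ∫ x, a j * (r * u x) ^ j * conj (u x) ^ k ∂μ)
        (∫ x, G (r * u x) * conj (u x) ^ k ∂μ) := by
      refine hasSum_integral_of_norm_le (fun j => by fun_prop) (has r hr.1 hr.2) (fun j x => ?_)
        fun x => (ha _ ((hru x).trans_lt hr.2)).mul_right _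
      rw [norm_mul, norm_mul, norm_pow, norm_pow, RCLike.norm_conj]
      refine (mul_le_of_le_one_right (by positivity) (pow_le_one₀ (norm_nonneg _) (hu1 x))).trans ?_
      gcongr
      exact hru x
    have h2 : ∀ j, ∫ x, a j * (r * u x) ^ j * conj (u x) ^ k ∂μ =
        a j * r ^ j * ∫ x, u x ^ j * conj (u x) ^ k ∂μ := by
      intro j
      rw [← integral_const_mul]
      refine integral_congr_ae (Filter.Eventually.of_forall fun x => ?_)
      simp only [mul_pow]
      ring
    simp_rw [h2] at h1
    exact h1.unique (hasSum_single k fun j hj => by rw [horth j k hj, mul_zero])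
  have hzc : Summable fun k => B * (‖c k‖ * ‖z‖ ^ k) := by
    refine Summable.mul_left _ ?_
    simpa using (hκ z hz).summable.norm
  have h1 : HasSum (fun k => ∫ x, G (r * u x) * (c k * (z * conj (u x)) ^ k) ∂μ)
      (∫ x, G (r * u x) * κ (z * conj (u x)) ∂μ) := by
    refine hasSum_integral_of_norm_le (fun k => ?_) hzc (fun k x => ?_) fun x => ?_
    · have := Complex.continuous_conj.comp hu
      exact hGc.mul (continuous_const.mul ((continuous_const.mul this).pow k))
    · rw [norm_mul, norm_mul, norm_pow, norm_mul, RCLike.norm_conj]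
      have : ‖z‖ * ‖u x‖ ≤ ‖z‖ := mul_le_of_le_one_right (norm_nonneg _) (hu1 x)
      have hB0 : 0 ≤ B := (norm_nonneg _).trans (hB x)
      gcongr
      exact hB x
    · refine (hκ _ ?_).mul_left _
      rw [norm_mul, RCLike.norm_conj]
      exact (mul_le_of_le_one_right (norm_nonneg _) (hu1 x)).trans_lt hz
  have h2 : ∀ k, ∫ x, G (r * u x) * (c k * (z * conj (u x)) ^ k) ∂μ = a k * (r * z) ^ k := by
    intro k
    have e : ∀ x, G (r * u x) * (c k * (z * conj (u x)) ^ k) =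
        (c k * z ^ k) * (G (r * u x) * conj (u x) ^ k) := fun x => by rw [mul_pow]; ring
    simp_rw [e]
    rw [integral_const_mul, step, mul_pow]
    linear_combination (a k * r ^ k * z ^ k) * hc k
  simp_rw [h2] at h1
  refine h1.unique (ha _ ?_)
  rw [norm_mul, Complex.norm_real, Real.norm_of_nonneg hr.1]
  exact (mul_le_of_le_one_right hr.1 hz.le).trans_lt hr.2

end PowerSeries

/-! ### Fourier orthogonality and the Cauchy formula on the circle. -/

theorem integral_toCircle_pow_mul_conj_pow (j k : ℕ) :
    ∫ t : UnitAddCircle, (AddCircle.toCircle t : ℂ) ^ j * conj (AddCircle.toCircle t : ℂ) ^ k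
      ∂AddCircle.haarAddCircle = if j = k then 1 else 0 := by
  have h := congrFun (fourierCoeff_fourier (T := 1) (j : ℤ)) (k : ℤ)
  rw [fourierCoeff] at h
  have e : ∀ (m : ℕ) (t : UnitAddCircle), fourier (m : ℤ) t = (AddCircle.toCircle t : ℂ) ^ m := by
    intro m t
    rw [fourier_apply, AddCircle.toCircle_zsmul]
    simp
  simp_rw [fourier_neg, e, map_pow, smul_eq_mul] at h
  simp_rw [mul_comm (_ ^ j), h, Pi.single_apply]
  simp [eq_comm]

/-- The Cauchy formula on circles around the origin. -/
theorem integral_comp_toCircle_mul_inv {G : ℂ → ℂ} (hG : DifferentiableOn ℂ G (Metric.ball 0 1))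
    {r : ℝ} (hr : r ∈ Set.Ico (0 : ℝ) 1) {z : ℂ} (hz : ‖z‖ < 1) :
    ∫ t : UnitAddCircle, G (r * AddCircle.toCircle t) *
      (1 - z * conj (AddCircle.toCircle t : ℂ))⁻¹ ∂AddCircle.haarAddCircle = G (r * z) := by
  refine integral_comp_mul_kernel_eq (u := fun t : UnitAddCircle => (AddCircle.toCircle t : ℂ))
    (c := fun _ => 1) (κ := fun w => (1 - w)⁻¹)
    (continuous_subtype_val.comp AddCircle.continuous_toCircle) (fun t => (Circle.norm_coe _).le)
    (fun j k hjk => by simp [integral_toCircle_pow_mul_conj_pow, hjk])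
    (fun k => by simp [integral_toCircle_pow_mul_conj_pow]) (fun w hw => ?_) hG hr hz
  simpa using hasSum_geometric_of_norm_lt_one hw

theorem integral_comp_toCircle {G : ℂ → ℂ} (hG : DifferentiableOn ℂ G (Metric.ball 0 1))
    {r : ℝ} (hr : r ∈ Set.Ico (0 : ℝ) 1) :
    ∫ t : UnitAddCircle, G (r * AddCircle.toCircle t) ∂AddCircle.haarAddCircle = G 0 := by
  simpa using integral_comp_toCircle_mul_inv hG hr (z := 0) (by simp)

/-! ### The Szegő kernel of the polydisc. -/

section Polydisc

/-- The Szegő kernel of the polydisc. -/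
def polydiscKernel (n : ℕ) (z w : Fin n → ℂ) : ℂ := ∏ i, (1 - z i * conj (w i))⁻¹

/-- The parametrization of the distinguished boundary of the polydisc. -/
def torusEmb (n : ℕ) (t : UnitAddTorus (Fin n)) (i : Fin n) : ℂ := AddCircle.toCircle (t i)

/-- The normalized Haar measure of the torus. -/
abbrev torusMeasure (n : ℕ) : Measure (UnitAddTorus (Fin n)) :=
  Measure.pi fun _ => AddCircle.haarAddCircle

theorem continuous_torusEmb (n : ℕ) : Continuous (torusEmb n) :=
  continuous_pi fun i =>
    continuous_subtype_val.comp (AddCircle.continuous_toCircle.comp (continuous_apply i))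

theorem norm_torusEmb (n : ℕ) (t : UnitAddTorus (Fin n)) (i : Fin n) : ‖torusEmb n t i‖ = 1 :=
  Circle.norm_coe _

theorem smul_torusEmb_mem {n : ℕ} {r : ℝ} (hr : r ∈ Set.Ico (0 : ℝ) 1)
    (t : UnitAddTorus (Fin n)) : (r : ℂ) • torusEmb n t ∈ polydisc n := by
  intro i
  rw [Pi.smul_apply, norm_smul, norm_torusEmb, mul_one, Complex.norm_real,
    Real.norm_of_nonneg hr.1]
  exact hr.2

theorem norm_mul_conj_lt_one {a b : ℂ} (ha : ‖a‖ < 1) (hb : ‖b‖ ≤ 1) : ‖a * conj b‖ < 1 := by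
  rw [norm_mul, RCLike.norm_conj]
  exact (mul_le_of_le_one_right (norm_nonneg _) hb).trans_lt ha

theorem one_sub_mul_conj_ne_zero {a b : ℂ} (ha : ‖a‖ < 1) (hb : ‖b‖ ≤ 1) :
    1 - a * conj b ≠ 0 := by
  intro h
  have := norm_mul_conj_lt_one ha hb
  rw [← sub_eq_zero.1 h, norm_one] at this
  exact lt_irrefl _ this

theorem continuous_polydiscKernel_torusEmb {n : ℕ} {z : Fin n → ℂ} (hz : z ∈ polydisc n) :
    Continuous fun t => polydiscKernel n z (torusEmb n t) := by
  refine continuous_finsetProd _ fun i _ => Continuous.inv₀ ?_ fun t =>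
    one_sub_mul_conj_ne_zero (hz i) (norm_torusEmb n t i).le
  exact continuous_const.sub (continuous_const.mul (Complex.continuous_conj.comp
    ((continuous_apply i).comp (continuous_torusEmb n))))

theorem isOpen_polydisc (n : ℕ) : IsOpen (polydisc n) := by
  have : polydisc n = ⋂ i, {z : Fin n → ℂ | ‖z i‖ < 1} := by ext z; simp [polydisc]
  rw [this]
  exact isOpen_iInter_of_finite fun i =>
    isOpen_lt (continuous_norm.comp (continuous_apply i)) continuous_const

theorem cons_mem_polydisc {n : ℕ} {a : ℂ} {z : Fin n → ℂ} (ha : ‖a‖ < 1) (hz : z ∈ polydisc n) :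
    (Fin.cons a z : Fin (n + 1) → ℂ) ∈ polydisc (n + 1) :=
  Fin.cases ha hz

/-- The Cauchy formula on the polydisc. -/
theorem integral_comp_torusEmb_mul_polydiscKernel {n : ℕ} {g : (Fin n → ℂ) → ℂ}
    (hg : DifferentiableOn ℂ g (polydisc n)) {r : ℝ} (hr : r ∈ Set.Ico (0 : ℝ) 1)
    {z : Fin n → ℂ} (hz : z ∈ polydisc n) :
    ∫ t, g ((r : ℂ) • torusEmb n t) * polydiscKernel n z (torusEmb n t) ∂torusMeasure n =
      g ((r : ℂ) • z) := by
  induction n with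
  | zero =>
    have e : ∀ t, (r : ℂ) • torusEmb 0 t = (r : ℂ) • z := fun t => Subsingleton.elim _ _
    simp [e, polydiscKernel]
  | succ n ih =>
    set f : UnitAddTorus (Fin (n + 1)) → ℂ := fun t =>
      g ((r : ℂ) • torusEmb (n + 1) t) * polydiscKernel (n + 1) z (torusEmb (n + 1) t) with hf
    have hgc : Continuous fun t => g ((r : ℂ) • torusEmb (n + 1) t) :=
      hg.continuousOn.comp_continuous ((continuous_torusEmb _).const_smul (r : ℂ))
        fun t => smul_torusEmb_mem hr t
    have hfc : Continuous f := hgc.mul (continuous_polydiscKernel_torusEmb hz)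
    have hmp := (measurePreserving_piFinSuccAbove
      (fun _ : Fin (n + 1) => (AddCircle.haarAddCircle : Measure UnitAddCircle)) 0).symm
    have h1 := hmp.integral_comp' f
    have h2 : Integrable (fun p : UnitAddCircle × UnitAddTorus (Fin n) => f (Fin.cons p.1 p.2))
        (AddCircle.haarAddCircle.prod (torusMeasure n)) := by
      refine integrable_of_continuous (hfc.comp ?_)
      exact continuous_pi (Fin.cases continuous_fst
        fun i => (continuous_apply i).comp continuous_snd)
    have h3 : ∫ p : UnitAddCircle × UnitAddTorus (Fin n), f (Fin.cons p.1 p.2)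
        ∂(AddCircle.haarAddCircle.prod (torusMeasure n)) = ∫ t, f t ∂torusMeasure (n + 1) := by
      rw [← h1]
      refine integral_congr_ae (Filter.Eventually.of_forall fun p => ?_)
      simp only [MeasurableEquiv.piFinSuccAbove, Fin.insertNthEquiv_zero]
      rfl
    rw [← h3, integral_prod _ h2]
    set z' : Fin n → ℂ := fun i => z i.succ with hz'
    have hz'D : z' ∈ polydisc n := fun i => hz i.succ
    have hru : ∀ t : UnitAddCircle, ‖(r : ℂ) * AddCircle.toCircle t‖ < 1 := by
      intro t
      rw [norm_mul, Circle.norm_coe, mul_one, Complex.norm_real, Real.norm_of_nonneg hr.1]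
      exact hr.2
    have hrz' : (r : ℂ) • z' ∈ polydisc n := by
      intro i
      rw [Pi.smul_apply, norm_smul, Complex.norm_real, Real.norm_of_nonneg hr.1]
      exact (mul_le_of_le_one_right hr.1 (hz'D i).le).trans_lt hr.2
    -- With the first coordinate frozen, the inner integral is the formula in dimension `n`; the
    -- outer one is then the one-variable Cauchy formula.
    have hin : ∀ t₀ : UnitAddCircle, ∫ t, f (Fin.cons t₀ t) ∂torusMeasure n =
        g (Fin.cons ((r : ℂ) * AddCircle.toCircle t₀) ((r : ℂ) • z')) *
          (1 - z 0 * conj (AddCircle.toCircle t₀ : ℂ))⁻¹ := by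
      intro t₀
      have hg' : DifferentiableOn ℂ
          (fun w : Fin n → ℂ => g (Fin.cons ((r : ℂ) * AddCircle.toCircle t₀) w)) (polydisc n) := by
        refine hg.comp (Differentiable.differentiableOn ?_)
          fun w hw => cons_mem_polydisc (hru t₀) hw
        exact differentiable_pi.2 (Fin.cases (differentiable_const _)
          fun i => differentiable_apply i)
      rw [← ih hg' hz'D, ← integral_mul_const]
      refine integral_congr_ae (Filter.Eventually.of_forall fun t => ?_)
      have e : (r : ℂ) • torusEmb (n + 1) (Fin.cons t₀ t) =
          Fin.cons ((r : ℂ) * AddCircle.toCircle t₀) ((r : ℂ) • torusEmb n t) := by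
        funext i
        refine Fin.cases ?_ (fun i => ?_) i <;> simp [torusEmb]
      have e2 : polydiscKernel (n + 1) z (torusEmb (n + 1) (Fin.cons t₀ t)) =
          (1 - z 0 * conj (AddCircle.toCircle t₀ : ℂ))⁻¹ * polydiscKernel n z' (torusEmb n t) := by
        simp [polydiscKernel, Fin.prod_univ_succ, torusEmb, hz', mul_comm]
      simp only [hf, e, e2]
      ring
    simp_rw [hin]
    have hG : DifferentiableOn ℂ
        (fun w : ℂ => g (Fin.cons w ((r : ℂ) • z'))) (Metric.ball 0 1) := by
      refine hg.comp (Differentiable.differentiableOn ?_)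
        fun w hw => cons_mem_polydisc (by simpa using hw) hrz'
      exact differentiable_pi.2 (Fin.cases differentiable_id fun i => differentiable_const _)
    rw [integral_comp_toCircle_mul_inv hG hr (hz 0)]
    congr 1
    funext i
    refine Fin.cases ?_ (fun i => ?_) i <;> simp [hz']

theorem isSzegoKernel_polydisc (n : ℕ) :
    IsSzegoKernel (polydisc n) (torusMeasure n) (torusEmb n) (polydiscKernel n) where
  isOpen := isOpen_polydisc n
  smul_boundary_mem r hr t := smul_torusEmb_mem hr t
  exists_inv_smul_mem z hz := by
    have hz1 : ‖z‖ < 1 := (pi_norm_lt_iff one_pos).2 hz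
    obtain ⟨ρ, h1, h2⟩ := exists_between hz1
    have h0 : 0 < ρ := (norm_nonneg _).trans_lt h1
    refine ⟨ρ, ⟨h0, h2⟩, fun i => ?_⟩
    rw [Pi.smul_apply, norm_smul, Complex.norm_real, Real.norm_of_nonneg (by positivity),
      inv_mul_lt_iff₀ h0, mul_one]
    exact (norm_le_pi_norm z i).trans_lt h1
  continuous_boundary := continuous_torusEmb n
  conj_apply z w := by
    simp [polydiscKernel, mul_comm]
  apply_smul r z w := by
    simp only [polydiscKernel, Pi.smul_apply, smul_eq_mul, map_mul, Complex.conj_ofReal]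
    exact Finset.prod_congr rfl fun i _ => by ring_nf
  apply_ne_zero z hz w hw :=
    Finset.prod_ne_zero_iff.2 fun i _ => inv_ne_zero (one_sub_mul_conj_ne_zero (hz i) (hw i).le)
  bounded w hw := by
    refine ⟨∏ i, (1 - ‖w i‖)⁻¹, fun z hz => ?_⟩
    rw [polydiscKernel, norm_prod]
    refine Finset.prod_le_prod (fun _ _ => norm_nonneg _) fun i _ => ?_
    have h1 : 0 < 1 - ‖w i‖ := sub_pos.2 (hw i)
    rw [norm_inv]
    refine inv_anti₀ h1 ?_
    have h2 := norm_sub_norm_le 1 (z i * conj (w i))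
    rw [norm_one, norm_mul, RCLike.norm_conj] at h2
    nlinarith [mul_le_of_le_one_left (norm_nonneg (w i)) (hz i).le]
  differentiableOn w hw := by
    have h : ∀ i, DifferentiableOn ℂ (fun z : Fin n → ℂ => (1 - z i * conj (w i))⁻¹) (polydisc n) :=
      fun i => DifferentiableOn.fun_inv (by fun_prop)
        fun z hz => one_sub_mul_conj_ne_zero (hz i) (hw i).le
    exact fun z hz => (HasFDerivWithinAt.finsetProd
      fun i _ => (h i z hz).hasFDerivWithinAt).differentiableWithinAt
  continuousOn := by
    refine continuousOn_finsetProd _ fun i _ => ContinuousOn.inv₀ ?_ fun p hp =>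
      one_sub_mul_conj_ne_zero (hp.1 i) (hp.2 i).le
    have : Continuous fun p : (Fin n → ℂ) × (Fin n → ℂ) => conj (p.2 i) :=
      Complex.continuous_conj.comp ((continuous_apply i).comp continuous_snd)
    fun_prop
  reproducing g hg r hr z hz := integral_comp_torusEmb_mul_polydiscKernel hg hr hz

theorem boundedComp_polydisc (n : ℕ) {φ : (Fin n → ℂ) → (Fin n → ℂ)}
    (hφ : IsHolSelfMap (polydisc n) φ)
    (hK : IsKernelOn (polydisc n)
      fun z w => ∏ i, (1 - conj (φ w i) * φ z i) / (1 - conj (w i) * z i)) :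
    BoundedComp (polydiscHardySpace n) polydiscHardyNorm φ := by
  refine (isSzegoKernel_polydisc n).boundedComp hφ (hK.congr fun z _ w _ => ?_)
  simp only [polydiscKernel]
  rw [← Finset.prod_div_distrib]
  refine Finset.prod_congr rfl fun i _ => ?_
  rw [div_inv_eq_mul, div_eq_inv_mul, mul_comm (conj (w i)), mul_comm (conj (φ w i))]

end Polydisc

/-! ### Unitary invariance of the sphere measure and moments of a coordinate. -/

section Sphere

variable {n : ℕ}

/-- The image of Haar measure is a multiple of it by uniqueness, and the invariant unit ball shows
that the factor is `1`. -/
theorem measurePreserving_linearIsometryEquiv (U : Cn n ≃ₗᵢ[ℂ] Cn n) :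
    MeasurePreserving U (Measure.addHaar : Measure (Cn n)) Measure.addHaar := by
  refine ⟨U.continuous.measurable, ?_⟩
  set μ : Measure (Cn n) := Measure.addHaar with hμ
  have hU : (μ.map U).IsAddHaarMeasure :=
    AddEquiv.isAddHaarMeasure_map μ (U.toLinearEquiv.toAddEquiv) U.continuous U.symm.continuous
  obtain ⟨c, hc⟩ : ∃ c : ℝ≥0, μ.map U = c • μ := ⟨_, Measure.isAddLeftInvariant_eq_smul _ _⟩
  have hball : μ.map U (Metric.ball 0 1) = μ (Metric.ball 0 1) := by
    rw [Measure.map_apply U.continuous.measurable measurableSet_ball]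
    congr 1
    ext x
    simp
  rw [hc, Measure.smul_apply, ENNReal.smul_def, smul_eq_mul] at hball
  have h1 : c = 1 := by
    rw [← ENNReal.coe_inj, ENNReal.coe_one]
    have hp : μ (Metric.ball 0 1) ≠ 0 := (Metric.measure_ball_pos μ 0 one_pos).ne'
    have hf : μ (Metric.ball 0 1) ≠ ∞ := measure_ball_lt_top.ne
    rwa [← ENNReal.mul_eq_right hp hf]
  rw [hc, h1, one_smul]

/-- The action of a linear isometry on the unit sphere. -/
def sphereMap (U : Cn n ≃ₗᵢ[ℂ] Cn n) (ζ : Metric.sphere (0 : Cn n) 1) :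
    Metric.sphere (0 : Cn n) 1 :=
  ⟨U ζ, by simp⟩

/-- The action of a linear isometry on the unit sphere, as a homeomorphism. -/
def sphereHomeomorph (U : Cn n ≃ₗᵢ[ℂ] Cn n) :
    Metric.sphere (0 : Cn n) 1 ≃ₜ Metric.sphere (0 : Cn n) 1 where
  toFun := sphereMap U
  invFun := sphereMap U.symm
  left_inv ζ := by simp [sphereMap]
  right_inv ζ := by simp [sphereMap]
  continuous_toFun := (U.continuous.comp continuous_subtype_val).subtype_mk _
  continuous_invFun := (U.symm.continuous.comp continuous_subtype_val).subtype_mk _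

/-- The measure of a set in the sphere is defined through the volume of the cone over it, and a
linear isometry maps cones to cones. -/
theorem map_sphereMap_sphereMeasure (U : Cn n ≃ₗᵢ[ℂ] Cn n) :
    (sphereMeasure n).map (sphereMap U) = sphereMeasure n := by
  have hm : Measurable (sphereMap U) := (sphereHomeomorph U).continuous.measurable
  rw [sphereMeasure, Measure.map_smul]
  congr 1
  ext s hs
  rw [Measure.map_apply hm hs, Measure.toSphere_apply' _ hs, Measure.toSphere_apply' _ (hm hs)]
  congr 1
  symm
  rw [← (measurePreserving_linearIsometryEquiv U).measure_preimage_emb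
    U.toHomeomorph.measurableEmbedding]
  congr 1
  ext x
  simp only [Set.mem_smul, Set.mem_preimage, Set.mem_image]
  have hsm : ∀ (V : Cn n ≃ₗᵢ[ℂ] Cn n) (r : ℝ) (y : Cn n), V (r • y) = r • V y := fun V r y =>
    map_real_smul V.toLinearEquiv.toAddEquiv.toAddMonoidHom V.continuous r y
  constructor
  · rintro ⟨r, hr, _, ⟨ζ, hζ, rfl⟩, hx⟩
    refine ⟨r, hr, _, ⟨sphereMap U.symm ζ, ?_, rfl⟩, ?_⟩
    · have : sphereMap U (sphereMap U.symm ζ) = ζ := (sphereHomeomorph U).right_inv ζ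
      rwa [this]
    · apply U.injective
      rw [← hx, hsm]
      exact congrArg (r • ·) (U.apply_symm_apply _)
  · rintro ⟨r, hr, _, ⟨ζ, hζ, rfl⟩, rfl⟩
    exact ⟨r, hr, _, ⟨sphereMap U ζ, hζ, rfl⟩, (hsm U r ζ).symm⟩

theorem integral_sphere_comp (U : Cn n ≃ₗᵢ[ℂ] Cn n) (F : Cn n → ℂ) :
    ∫ ζ : Metric.sphere (0 : Cn n) 1, F (U ζ) ∂sphereMeasure n =
      ∫ ζ : Metric.sphere (0 : Cn n) 1, F ζ ∂sphereMeasure n := by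
  have h : MeasurePreserving (sphereMap U) (sphereMeasure n) (sphereMeasure n) :=
    ⟨(sphereHomeomorph U).continuous.measurable, map_sphereMap_sphereMeasure U⟩
  exact h.integral_comp (sphereHomeomorph U).measurableEmbedding
    fun ζ : Metric.sphere (0 : Cn n) 1 => F ζ

theorem isProbabilityMeasure_sphereMeasure [NeZero n] : IsProbabilityMeasure (sphereMeasure n) := by
  refine ⟨?_⟩
  rw [sphereMeasure, Measure.smul_apply, smul_eq_mul]
  refine ENNReal.inv_mul_cancel ?_ (measure_ne_top _ _)
  rw [Ne, Measure.measure_univ_eq_zero]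
  exact Measure.toSphere_ne_zero _

theorem finrank_real_Cn : Module.finrank ℝ (Cn n) = 2 * n := by
  rw [← Module.finrank_mul_finrank ℝ ℂ (Cn n), Complex.finrank_real_complex,
    finrank_euclideanSpace_fin]

/-- Polar coordinates: the radial factor is `∫ ρ^(2n-1+2k) exp(-ρ²) = Γ(n+k)/2`, where `2n - 1`
comes from the real dimension `2n`. -/
theorem integral_gaussian_polar [NeZero n] (k : ℕ) :
    ∫ x : Cn n, ‖x 0‖ ^ (2 * k) * Real.exp (-‖x‖ ^ 2) ∂Measure.addHaar =
      (∫ ζ : Metric.sphere (0 : Cn n) 1, ‖(ζ : Cn n) 0‖ ^ (2 * k)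
        ∂(Measure.addHaar : Measure (Cn n)).toSphere) * (Real.Gamma (n + k) / 2) := by
  set μ : Measure (Cn n) := Measure.addHaar with hμ
  set g : Metric.sphere (0 : Cn n) 1 × Set.Ioi (0 : ℝ) → ℝ := fun p =>
    ‖(p.1 : Cn n) 0‖ ^ (2 * k) * ((p.2 : ℝ) ^ (2 * k) * Real.exp (-(p.2 : ℝ) ^ 2)) with hg
  have h1 : ∫ x : Cn n, ‖x 0‖ ^ (2 * k) * Real.exp (-‖x‖ ^ 2) ∂μ =
      ∫ x : ({(0)}ᶜ : Set (Cn n)), g (homeomorphUnitSphereProd (Cn n) x) ∂(μ.comap (↑)) := by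
    conv_lhs => rw [← restrict_compl_singleton (μ := μ) 0,
      ← integral_subtype_comap (measurableSet_singleton _).compl
        fun x : Cn n => ‖x 0‖ ^ (2 * k) * Real.exp (-‖x‖ ^ 2)]
    refine integral_congr_ae (Filter.Eventually.of_forall fun x => ?_)
    have hx : ‖(x : Cn n)‖ ≠ 0 := norm_ne_zero_iff.2 x.2
    simp only [hg, homeomorphUnitSphereProd_apply_fst_coe, homeomorphUnitSphereProd_apply_snd_coe,
      PiLp.smul_apply, norm_smul, norm_inv, norm_norm, mul_pow, inv_pow]
    field_simp
  rw [h1, μ.measurePreserving_homeomorphUnitSphereProd.integral_comp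
    (Homeomorph.measurableEmbedding _) g, hg,
    integral_prod_mul (fun ζ : Metric.sphere (0 : Cn n) 1 => ‖(ζ : Cn n) 0‖ ^ (2 * k))
      (fun ρ : Set.Ioi (0 : ℝ) => (ρ : ℝ) ^ (2 * k) * Real.exp (-(ρ : ℝ) ^ 2))]
  congr 1
  rw [finrank_real_Cn]
  simp only [Measure.volumeIoiPow, ENNReal.ofReal]
  rw [integral_withDensity_eq_integral_smul
      ((measurable_subtype_coe.pow_const _).real_toNNReal),
    integral_subtype_comap measurableSet_Ioi fun a : ℝ => Real.toNNReal (a ^ (2 * n - 1)) •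
      (a ^ (2 * k) * Real.exp (-a ^ 2))]
  have h2 := integral_rpow_mul_exp_neg_rpow (p := 2) (q := (2 * n - 1 + 2 * k : ℕ)) (by norm_num)
    (lt_of_lt_of_le (by norm_num) (Nat.cast_nonneg _))
  have hn : 1 ≤ n := NeZero.one_le
  rw [show (((2 * n - 1 + 2 * k : ℕ) : ℝ) + 1) / 2 = n + k by
    rw [Nat.cast_add, Nat.cast_sub (by omega)]; push_cast; ring] at h2
  rw [div_eq_mul_one_div, mul_comm (Real.Gamma _), ← h2]
  refine setIntegral_congr_fun measurableSet_Ioi fun x hx => ?_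
  have hx0 : 0 ≤ x := (Set.mem_Ioi.1 hx).le
  simp only [NNReal.smul_def, Real.coe_toNNReal _ (pow_nonneg hx0 _), smul_eq_mul,
    Real.rpow_natCast, Real.rpow_two]
  rw [pow_add, mul_assoc]

/-- The same Gaussian integral in Cartesian coordinates, where it is a product over the coordinates.
The constant absorbs the unspecified normalization of Haar measure; only its independence of `k`
matters. -/
theorem exists_integral_gaussian_eq [NeZero n] :
    ∃ C : ℝ, ∀ k : ℕ, ∫ x : Cn n, ‖x 0‖ ^ (2 * k) * Real.exp (-‖x‖ ^ 2) ∂Measure.addHaar =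
      C * k.factorial := by
  set e : (Fin n → ℂ) ≃L[ℂ] Cn n := (EuclideanSpace.equiv (Fin n) ℂ).symm with he
  have hmap : ((volume : Measure (Fin n → ℂ)).map e).IsAddHaarMeasure :=
    ContinuousLinearEquiv.isAddHaarMeasure_map e _
  obtain ⟨c, hc⟩ : ∃ c : ℝ≥0, (Measure.addHaar : Measure (Cn n)) =
      c • (volume : Measure (Fin n → ℂ)).map e := ⟨_, Measure.isAddLeftInvariant_eq_smul _ _⟩
  refine ⟨c * Real.pi ^ n, fun k => ?_⟩
  have hemb : MeasurableEmbedding e := e.toHomeomorph.measurableEmbedding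
  rw [hc, integral_smul_nnreal_measure, hemb.integral_map]
  have h1 : ∀ x : Fin n → ℂ, ‖(e x) 0‖ ^ (2 * k) * Real.exp (-‖e x‖ ^ 2) =
      ∏ i, (if i = 0 then ‖x i‖ ^ (2 * k) else 1) * Real.exp (-‖x i‖ ^ 2) := by
    intro x
    rw [Finset.prod_mul_distrib, Finset.prod_ite_eq' Finset.univ (0 : Fin n), if_pos (Finset.mem_univ _),
      ← Real.exp_sum, EuclideanSpace.norm_sq_eq, Finset.sum_neg_distrib]
    rfl
  have h2 : ∀ m : ℕ, ∫ w : ℂ, ‖w‖ ^ (2 * m) * Real.exp (-‖w‖ ^ 2) = Real.pi * m.factorial := by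
    intro m
    have := Complex.integral_rpow_mul_exp_neg_rpow (p := 2) (q := (2 * m : ℕ)) (by norm_num)
      (lt_of_lt_of_le (by norm_num) (Nat.cast_nonneg _))
    simp only [Real.rpow_natCast, Real.rpow_two] at this
    rw [this, show (((2 * m : ℕ) : ℝ) + 2) / 2 = m + 1 by push_cast; ring,
      Real.Gamma_nat_eq_factorial]
    ring
  have h3 : ∀ i : Fin n, ∫ w : ℂ, (if i = 0 then ‖w‖ ^ (2 * k) else 1) * Real.exp (-‖w‖ ^ 2) =
      Real.pi * if i = 0 then (k.factorial : ℝ) else 1 := by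
    intro i
    split_ifs
    · exact h2 k
    · simpa using h2 0
  rw [integral_congr_ae (Filter.Eventually.of_forall h1)]
  rw [integral_fintype_prod_volume_eq_prod (fun (i : Fin n) (w : ℂ) =>
    (if i = 0 then ‖w‖ ^ (2 * k) else 1) * Real.exp (-‖w‖ ^ 2))]
  simp_rw [h3]
  rw [Finset.prod_mul_distrib, Finset.prod_ite_eq' Finset.univ (0 : Fin n),
    if_pos (Finset.mem_univ _), Finset.prod_const, Finset.card_univ, Fintype.card_fin, NNReal.smul_def,
    smul_eq_mul, mul_assoc]

/-- Equating the two Gaussian computations gives the moments up to a constant, which dividing by the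
case `k = 0` removes. The binomial coefficients are the Taylor coefficients of `(1 - w)^(-(m+1))`,
so the Szegő kernel on the first axis has the coefficients required by
`integral_comp_mul_kernel_eq`. -/
theorem integral_sphere_norm_pow (m k : ℕ) :
    ((k + m).choose m : ℝ) * ∫ ζ : Metric.sphere (0 : Cn (m + 1)) 1, ‖(ζ : Cn (m + 1)) 0‖ ^ (2 * k)
      ∂sphereMeasure (m + 1) = 1 := by
  obtain ⟨C, hC⟩ := exists_integral_gaussian_eq (n := m + 1)
  have := isProbabilityMeasure_sphereMeasure (n := m + 1)
  set σ := (Measure.addHaar : Measure (Cn (m + 1))).toSphere with hσ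
  have hJ : ∀ k : ℕ, (∫ ζ : Metric.sphere (0 : Cn (m + 1)) 1, ‖(ζ : Cn (m + 1)) 0‖ ^ (2 * k) ∂σ) *
      (((m + k).factorial : ℝ) / 2) = C * k.factorial := by
    intro k
    rw [← hC, integral_gaussian_polar]
    congr 2
    rw [← Real.Gamma_nat_eq_factorial]
    congr 1
    push_cast
    ring
  have hs : ∀ F : Metric.sphere (0 : Cn (m + 1)) 1 → ℝ, ∫ ζ, F ζ ∂sphereMeasure (m + 1) =
      (σ Set.univ)⁻¹.toReal * ∫ ζ, F ζ ∂σ := by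
    intro F
    rw [sphereMeasure, integral_smul_measure, smul_eq_mul]
  have h1 : (σ Set.univ)⁻¹.toReal * ∫ _ : Metric.sphere (0 : Cn (m + 1)) 1, (1 : ℝ) ∂σ = 1 := by
    rw [← hs]; simp
  have h0 := hJ 0
  simp only [mul_zero, pow_zero, add_zero, Nat.factorial_zero, Nat.cast_one, mul_one] at h0
  have hk := hJ k
  rw [hs]
  have hfac : ((k + m).choose m : ℝ) * k.factorial * m.factorial = (m + k).factorial := by
    rw [add_comm m k]
    exact_mod_cast Nat.add_choose_mul_factorial_mul_factorial k m
  have hm : (m.factorial : ℝ) ≠ 0 := by positivity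
  have hkf : (k.factorial : ℝ) ≠ 0 := by positivity
  rw [← hfac, ← h0] at hk
  rw [mul_left_comm]
  refine Eq.trans ?_ h1
  congr 1
  refine mul_right_cancel₀ (mul_ne_zero hm hkf) ?_
  linarith

end Sphere

/-! ### The Szegő kernel of the ball. -/

section Ball

variable {n : ℕ}

/-- Multiplication by a complex number of modulus one. -/
def circleMul (a : Circle) : ℂ ≃ₗᵢ[ℂ] ℂ where
  toLinearEquiv := LinearEquiv.smulOfNeZero ℂ ℂ (a : ℂ) (Circle.coe_ne_zero a)
  norm_map' x := by
    change ‖(a : ℂ) • x‖ = ‖x‖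
    rw [norm_smul, Circle.norm_coe, one_mul]

/-- The diagonal unitary map with given entries. -/
def diagIsometry (d : Fin n → Circle) : Cn n ≃ₗᵢ[ℂ] Cn n :=
  LinearIsometryEquiv.piLpCongrRight 2 fun i => circleMul (d i)

theorem diagIsometry_apply (d : Fin n → Circle) (z : Cn n) (i : Fin n) :
    diagIsometry d z i = d i * z i := rfl

theorem continuous_diagIsometry_apply {T : Type*} [TopologicalSpace T] {d : T → Fin n → Circle}
    (hd : Continuous d) :
    Continuous fun p : Metric.sphere (0 : Cn n) 1 × T => diagIsometry (d p.2) p.1 := by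
  have h : Continuous fun p : Metric.sphere (0 : Cn n) 1 × T =>
      (WithLp.toLp 2 fun i => (d p.2 i : ℂ) * (p.1 : Cn n) i : Cn n) := by
    refine (PiLp.continuous_toLp 2 _).comp (continuous_pi fun i => Continuous.mul ?_ ?_)
    · exact continuous_subtype_val.comp
        ((continuous_apply i).comp (hd.comp continuous_snd))
    · exact (EuclideanSpace.proj (𝕜 := ℂ) i).continuous.comp
        (continuous_subtype_val.comp continuous_fst)
  exact h

/-- Integration over the sphere may be preceded by averaging over a family of diagonal unitary
maps. -/
theorem integral_sphere_eq_integral_average [NeZero n] {d : UnitAddCircle → Fin n → Circle}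
    (hd : Continuous d) {F : Cn n → ℂ}
    (hF : Continuous fun ζ : Metric.sphere (0 : Cn n) 1 => F ζ) :
    ∫ ζ : Metric.sphere (0 : Cn n) 1, F ζ ∂sphereMeasure n =
      ∫ ζ : Metric.sphere (0 : Cn n) 1, ∫ t, F (diagIsometry (d t) ζ) ∂AddCircle.haarAddCircle
        ∂sphereMeasure n := by
  have := isProbabilityMeasure_sphereMeasure (n := n)
  have h2 : Continuous fun p : Metric.sphere (0 : Cn n) 1 × UnitAddCircle =>
      F (diagIsometry (d p.2) p.1) :=
    hF.comp ((continuous_diagIsometry_apply hd).subtype_mk fun p => by simp)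
  have h3 : Integrable (Function.uncurry fun (ζ : Metric.sphere (0 : Cn n) 1)
      (t : UnitAddCircle) => F (diagIsometry (d t) ζ))
      ((sphereMeasure n).prod AddCircle.haarAddCircle) :=
    integrable_of_continuous (f := fun p : Metric.sphere (0 : Cn n) 1 × UnitAddCircle =>
      F (diagIsometry (d p.2) p.1)) h2
  rw [integral_integral_swap h3]
  simp_rw [integral_sphere_comp]
  simp

/-- The Szegő kernel of the ball. -/
def ballKernel (n : ℕ) (z w : Cn n) : ℂ := ((1 - inner ℂ w z)⁻¹) ^ n

theorem norm_inner_lt_one {z w : Cn n} (hz : ‖z‖ < 1) (hw : ‖w‖ ≤ 1) : ‖inner ℂ w z‖ < 1 :=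
  (norm_inner_le_norm w z).trans_lt ((mul_le_of_le_one_left (norm_nonneg _) hw).trans_lt hz)

theorem one_sub_inner_ne_zero {z w : Cn n} (hz : ‖z‖ < 1) (hw : ‖w‖ ≤ 1) :
    1 - inner ℂ w z ≠ 0 := by
  intro h
  have := norm_inner_lt_one hz hw
  rw [← sub_eq_zero.1 h, norm_one] at this
  exact lt_irrefl _ this

theorem continuous_ballKernel_sphere {z : Cn n} (hz : ‖z‖ < 1) :
    Continuous fun ζ : Metric.sphere (0 : Cn n) 1 => ballKernel n z ζ := by
  refine Continuous.pow (Continuous.inv₀ ?_ fun ζ => one_sub_inner_ne_zero hz ?_) n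
  · exact continuous_const.sub (continuous_subtype_val.inner continuous_const)
  · simp

theorem smul_sphere_mem {r : ℝ} (hr : r ∈ Set.Ico (0 : ℝ) 1) (ζ : Metric.sphere (0 : Cn n) 1) :
    (r : ℂ) • (ζ : Cn n) ∈ unitBall n := by
  change ‖(r : ℂ) • (ζ : Cn n)‖ < 1
  rw [norm_smul, Complex.norm_real, Real.norm_of_nonneg hr.1, norm_eq_of_mem_sphere ζ, mul_one]
  exact hr.2

theorem isOpen_unitBall (n : ℕ) : IsOpen (unitBall n) :=
  isOpen_lt continuous_norm continuous_const

theorem norm_sphere_apply_le (ζ : Metric.sphere (0 : Cn n) 1) (i : Fin n) :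
    ‖(ζ : Cn n) i‖ ≤ 1 :=
  (PiLp.norm_apply_le (ζ : Cn n) i).trans_eq (norm_eq_of_mem_sphere ζ)

theorem continuous_sphere_apply (i : Fin n) :
    Continuous fun ζ : Metric.sphere (0 : Cn n) 1 => (ζ : Cn n) i :=
  (EuclideanSpace.proj (𝕜 := ℂ) i).continuous.comp continuous_subtype_val

/-- Averaging over scalar rotations multiplies the integrand by a nontrivial character of the
circle. -/
theorem integral_sphere_pow_mul_conj_pow [NeZero n] {j k : ℕ} (hjk : j ≠ k) :
    ∫ ζ : Metric.sphere (0 : Cn n) 1, (ζ : Cn n) 0 ^ j * conj ((ζ : Cn n) 0) ^ k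
      ∂sphereMeasure n = 0 := by
  rw [integral_sphere_eq_integral_average (d := fun t _ => AddCircle.toCircle t)
    (F := fun ζ : Cn n => ζ 0 ^ j * conj (ζ 0) ^ k)
    (continuous_pi fun _ => AddCircle.continuous_toCircle)
    (((continuous_sphere_apply 0).pow j).mul
      ((Complex.continuous_conj.comp (continuous_sphere_apply 0)).pow k))]
  have h : ∀ ζ : Cn n, ∫ t : UnitAddCircle,
      (diagIsometry (fun _ => AddCircle.toCircle t) ζ) 0 ^ j *
        conj ((diagIsometry (fun _ => AddCircle.toCircle t) ζ) 0) ^ k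
        ∂AddCircle.haarAddCircle = 0 := by
    intro ζ
    have e : ∀ t : UnitAddCircle, (diagIsometry (fun _ => AddCircle.toCircle t) ζ) 0 ^ j *
        conj ((diagIsometry (fun _ => AddCircle.toCircle t) ζ) 0) ^ k =
        ((AddCircle.toCircle t : ℂ) ^ j * conj (AddCircle.toCircle t : ℂ) ^ k) *
          (ζ 0 ^ j * conj (ζ 0) ^ k) := by
      intro t
      rw [diagIsometry_apply, map_mul]
      ring
    simp_rw [e]
    rw [integral_mul_const, integral_toCircle_pow_mul_conj_pow, if_neg hjk, zero_mul]
  simp_rw [h]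
  simp

theorem integral_sphere_pow_mul_conj_pow_self (m k : ℕ) :
    ((k + m).choose m : ℂ) * ∫ ζ : Metric.sphere (0 : Cn (m + 1)) 1,
      (ζ : Cn (m + 1)) 0 ^ k * conj ((ζ : Cn (m + 1)) 0) ^ k ∂sphereMeasure (m + 1) = 1 := by
  have e : ∀ w : ℂ, w ^ k * conj w ^ k = ((‖w‖ ^ (2 * k) : ℝ) : ℂ) := by
    intro w
    rw [← mul_pow, Complex.mul_conj', pow_mul]
    push_cast
    rfl
  simp_rw [e]
  rw [integral_complex_ofReal]
  exact_mod_cast integral_sphere_norm_pow m k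

/-- The point with first coordinate `a * ζ 0` and other coordinates `v * ζ i`. -/
def stretch {m : ℕ} (ζ : Cn (m + 1)) (a v : ℂ) : Cn (m + 1) :=
  WithLp.toLp 2 (Fin.cons (a * ζ 0) fun i => v * ζ i.succ)

theorem norm_stretch_lt {m : ℕ} (ζ : Metric.sphere (0 : Cn (m + 1)) 1) {a v : ℂ} (ha : ‖a‖ < 1)
    (hv : ‖v‖ < 1) : ‖stretch (ζ : Cn (m + 1)) a v‖ < 1 := by
  set ρ := max ‖a‖ ‖v‖ with hρ
  have hρ1 : ρ < 1 := max_lt ha hv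
  have hρ0 : 0 ≤ ρ := (norm_nonneg a).trans (le_max_left _ _)
  have h : ‖stretch (ζ : Cn (m + 1)) a v‖ ^ 2 ≤ ρ ^ 2 := by
    calc ‖stretch (ζ : Cn (m + 1)) a v‖ ^ 2 = ∑ i, ‖stretch (ζ : Cn (m + 1)) a v i‖ ^ 2 :=
          EuclideanSpace.norm_sq_eq _
      _ ≤ ∑ i, ρ ^ 2 * ‖(ζ : Cn (m + 1)) i‖ ^ 2 := by
          refine Finset.sum_le_sum fun i _ => ?_
          rw [← mul_pow]
          refine pow_le_pow_left₀ (norm_nonneg _) ?_ 2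
          refine Fin.cases ?_ (fun i => ?_) i
          · simp only [stretch, Fin.cons_zero, norm_mul]
            gcongr
            exact le_max_left _ _
          · simp only [stretch, Fin.cons_succ, norm_mul]
            gcongr
            exact le_max_right _ _
      _ = ρ ^ 2 * ‖(ζ : Cn (m + 1))‖ ^ 2 := by rw [← Finset.mul_sum, EuclideanSpace.norm_sq_eq]
      _ = ρ ^ 2 := by rw [norm_eq_of_mem_sphere ζ]; ring
  exact (pow_le_pow_iff_left₀ (norm_nonneg _) hρ0 two_ne_zero).1 h |>.trans_lt hρ1

theorem differentiable_stretch {m : ℕ} (ζ : Cn (m + 1)) (a : ℂ) :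
    Differentiable ℂ fun v => stretch ζ a v := by
  refine (PiLp.continuousLinearEquiv 2 ℂ (fun _ : Fin (m + 1) => ℂ)).symm.differentiable.comp ?_
  refine differentiable_pi.2 (Fin.cases ?_ fun i => ?_)
  · exact differentiable_const _
  · exact differentiable_id.mul_const _

/-- The Szegő formula at points of the first coordinate axis. -/
theorem integral_sphere_mul_ballKernel_axis {m : ℕ} {g : Cn (m + 1) → ℂ}
    (hg : DifferentiableOn ℂ g (unitBall (m + 1))) {r : ℝ} (hr : r ∈ Set.Ico (0 : ℝ) 1)
    {s : ℂ} (hs : ‖s‖ < 1) :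
    ∫ ζ : Metric.sphere (0 : Cn (m + 1)) 1, g ((r : ℂ) • (ζ : Cn (m + 1))) *
      ballKernel (m + 1) (EuclideanSpace.single 0 s) ζ ∂sphereMeasure (m + 1) =
      g ((r : ℂ) • EuclideanSpace.single 0 s) := by
  have := isProbabilityMeasure_sphereMeasure (n := m + 1)
  have hsn : ‖(EuclideanSpace.single 0 s : Cn (m + 1))‖ < 1 := by simpa using hs
  -- Rotate all coordinates but the first. The kernel at a point of the axis sees only the first
  -- coordinate, so by the mean value property the average replaces the other coordinates in `g` by
  -- `0`, which leaves a one-variable problem in `ζ 0`.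
  set d : UnitAddCircle → Fin (m + 1) → Circle :=
    fun t => Fin.cons 1 fun _ => AddCircle.toCircle t with hd
  have hdc : Continuous d :=
    continuous_pi (Fin.cases continuous_const fun _ => AddCircle.continuous_toCircle)
  have hgc : Continuous fun ζ : Metric.sphere (0 : Cn (m + 1)) 1 => g ((r : ℂ) • (ζ : Cn (m + 1))) :=
    hg.continuousOn.comp_continuous (continuous_subtype_val.const_smul (r : ℂ)) (smul_sphere_mem hr)
  rw [integral_sphere_eq_integral_average hdc
    (F := fun ζ => g ((r : ℂ) • ζ) * ballKernel (m + 1) (EuclideanSpace.single 0 s) ζ)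
    (hgc.mul (continuous_ballKernel_sphere hsn))]
  set G : ℂ → ℂ := fun w => g (EuclideanSpace.single 0 w) with hG
  have hGd : DifferentiableOn ℂ G (Metric.ball 0 1) := by
    refine hg.comp (Differentiable.differentiableOn ?_) fun w hw => ?_
    · refine (PiLp.continuousLinearEquiv 2 ℂ (fun _ : Fin (m + 1) => ℂ)).symm.differentiable.comp ?_
      refine differentiable_pi.2 fun i => ?_
      by_cases hi : i = 0
      · subst hi; simp
      · simp [hi]
    · simpa [unitBall] using hw
  have hin : ∀ ζ : Metric.sphere (0 : Cn (m + 1)) 1,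
      ∫ t, g ((r : ℂ) • diagIsometry (d t) ζ) *
        ballKernel (m + 1) (EuclideanSpace.single 0 s) (diagIsometry (d t) ζ)
        ∂AddCircle.haarAddCircle =
      G (r * (ζ : Cn (m + 1)) 0) * (1 / (1 - s * conj ((ζ : Cn (m + 1)) 0)) ^ (m + 1)) := by
    intro ζ
    have e1 : ∀ t, ballKernel (m + 1) (EuclideanSpace.single 0 s) (diagIsometry (d t) ζ) =
        1 / (1 - s * conj ((ζ : Cn (m + 1)) 0)) ^ (m + 1) := by
      intro t
      rw [ballKernel, EuclideanSpace.inner_single_right, diagIsometry_apply]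
      simp [hd]
    have e2 : ∀ t : UnitAddCircle, (r : ℂ) • diagIsometry (d t) (ζ : Cn (m + 1)) =
        stretch (ζ : Cn (m + 1)) r (r * AddCircle.toCircle t) := by
      intro t
      ext i
      rw [PiLp.smul_apply, diagIsometry_apply]
      refine Fin.cases ?_ (fun i => ?_) i
      · simp [stretch, hd]
      · simp [stretch, hd, mul_assoc]
    have hrn : ‖(r : ℂ)‖ < 1 := by
      rw [Complex.norm_real, Real.norm_of_nonneg hr.1]; exact hr.2
    have h3 := integral_comp_toCircle (G := fun v => g (stretch (ζ : Cn (m + 1)) r v))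
      (hg.comp (differentiable_stretch _ _).differentiableOn
        fun v hv => norm_stretch_lt ζ hrn (by simpa using hv)) hr
    have e4 : stretch (ζ : Cn (m + 1)) r 0 =
        EuclideanSpace.single 0 ((r : ℂ) * (ζ : Cn (m + 1)) 0) := by
      ext i
      refine Fin.cases ?_ (fun i => ?_) i
      · simp [stretch]
      · simp [stretch]
    simp_rw [e1, e2]
    rw [integral_mul_const, h3, e4]
  simp_rw [hin]
  have e5 : (r : ℂ) • (EuclideanSpace.single 0 s : Cn (m + 1)) =
      EuclideanSpace.single 0 ((r : ℂ) * s) := by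
    ext i
    by_cases hi : i = 0
    · subst hi; simp
    · simp [hi]
  rw [e5]
  exact integral_comp_mul_kernel_eq
    (u := fun ζ : Metric.sphere (0 : Cn (m + 1)) 1 => (ζ : Cn (m + 1)) 0)
    (c := fun k => ((k + m).choose m : ℂ)) (κ := fun w => 1 / (1 - w) ^ (m + 1))
    (continuous_sphere_apply 0) (fun ζ => norm_sphere_apply_le ζ 0)
    (fun j k hjk => integral_sphere_pow_mul_conj_pow hjk)
    (fun k => integral_sphere_pow_mul_conj_pow_self m k)
    (fun w hw => hasSum_choose_mul_geometric_of_norm_lt_one m hw) hGd hr hs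

/-- Extending `z / ‖z‖` to an orthonormal basis reduces the reproducing formula to points of the
first axis. -/
theorem exists_isometry_single {m : ℕ} (z : Cn (m + 1)) :
    ∃ (U : Cn (m + 1) ≃ₗᵢ[ℂ] Cn (m + 1)) (s : ℂ), ‖s‖ = ‖z‖ ∧
      z = U (EuclideanSpace.single 0 s) := by
  by_cases hz : z = 0
  · refine ⟨LinearIsometryEquiv.refl ℂ _, 0, by simp [hz], ?_⟩
    rw [hz]
    ext i
    simp
  have hz' : (‖z‖ : ℂ) ≠ 0 := by simpa using hz
  obtain ⟨b, hb⟩ := Orthonormal.exists_orthonormalBasis_extension_of_card_eq (𝕜 := ℂ)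
    (E := Cn (m + 1)) (ι := Fin (m + 1)) (by simp) (v := fun _ => (‖z‖ : ℂ)⁻¹ • z)
    (s := {0}) (by
      refine ⟨fun i => ?_, fun i j hij => (hij (Subsingleton.elim i j)).elim⟩
      simp [norm_smul, hz])
  have hb0 := hb 0 rfl
  refine ⟨b.repr.symm, ‖z‖, by simp, ?_⟩
  have e : (EuclideanSpace.single 0 (‖z‖ : ℂ) : Cn (m + 1)) =
      (‖z‖ : ℂ) • EuclideanSpace.single 0 1 := by
    ext i
    by_cases hi : i = 0
    · subst hi; simp
    · simp [hi]
  rw [e, map_smul, b.repr_symm_single, hb0, smul_smul, mul_inv_cancel₀ hz', one_smul]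

/-- The Szegő formula on the ball. -/
theorem integral_sphere_mul_ballKernel [NeZero n] {g : Cn n → ℂ}
    (hg : DifferentiableOn ℂ g (unitBall n)) {r : ℝ} (hr : r ∈ Set.Ico (0 : ℝ) 1)
    {z : Cn n} (hz : z ∈ unitBall n) :
    ∫ ζ : Metric.sphere (0 : Cn n) 1, g ((r : ℂ) • (ζ : Cn n)) * ballKernel n z ζ
      ∂sphereMeasure n = g ((r : ℂ) • z) := by
  obtain ⟨m, rfl⟩ := Nat.exists_eq_succ_of_ne_zero (NeZero.ne n)
  obtain ⟨U, s, hs, rfl⟩ := exists_isometry_single z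
  have hs1 : ‖s‖ < 1 := by
    rw [hs]; exact hz
  have h := integral_sphere_mul_ballKernel_axis (g := fun w => g (U w))
    (hg.comp U.differentiable.differentiableOn fun w hw => by simpa [unitBall] using hw) hr hs1
  rw [map_smul] at h
  rw [← h]
  refine (integral_sphere_comp U fun w => g ((r : ℂ) • w) *
    ballKernel (m + 1) (U (EuclideanSpace.single 0 s)) w).symm.trans ?_
  refine integral_congr_ae (Filter.Eventually.of_forall fun ζ => ?_)
  simp only [ballKernel, map_smul, LinearIsometryEquiv.inner_map_map]

theorem isSzegoKernel_ball [NeZero n] :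
    IsSzegoKernel (unitBall n) (sphereMeasure n)
      (fun ζ : Metric.sphere (0 : Cn n) 1 => (ζ : Cn n)) (ballKernel n) where
  isOpen := isOpen_unitBall n
  smul_boundary_mem r hr ζ := smul_sphere_mem hr ζ
  exists_inv_smul_mem z hz := by
    obtain ⟨ρ, h1, h2⟩ := exists_between (show ‖z‖ < 1 from hz)
    have h0 : 0 < ρ := (norm_nonneg _).trans_lt h1
    refine ⟨ρ, ⟨h0, h2⟩, ?_⟩
    change ‖((ρ⁻¹ : ℝ) : ℂ) • z‖ < 1
    rwa [norm_smul, Complex.norm_real, Real.norm_of_nonneg (by positivity),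
      inv_mul_lt_iff₀ h0, mul_one]
  continuous_boundary := continuous_subtype_val
  conj_apply z w := by
    simp [ballKernel]
  apply_smul r z w := by
    simp only [ballKernel, inner_smul_left, inner_smul_right, Complex.conj_ofReal]
  apply_ne_zero z hz w hw :=
    pow_ne_zero _ (inv_ne_zero (one_sub_inner_ne_zero hz (le_of_lt hw)))
  bounded w hw := by
    refine ⟨((1 - ‖w‖)⁻¹) ^ n, fun z hz => ?_⟩
    have h1 : 0 < 1 - ‖w‖ := sub_pos.2 hw
    rw [ballKernel, norm_pow, norm_inv]
    refine pow_le_pow_left₀ (by positivity) (inv_anti₀ h1 ?_) n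
    have h2 := norm_sub_norm_le 1 (inner ℂ w z)
    rw [norm_one] at h2
    have h3 := norm_inner_le_norm (𝕜 := ℂ) w z
    have h4 : ‖z‖ < 1 := hz
    nlinarith [mul_le_of_le_one_right (norm_nonneg w) h4.le]
  differentiableOn w hw := by
    have h : Differentiable ℂ fun z : Cn n => 1 - inner ℂ w z :=
      (differentiable_const _).sub (innerSL ℂ w).differentiable
    exact (h.differentiableOn.fun_inv fun z hz => one_sub_inner_ne_zero hz (le_of_lt hw)).pow n
  continuousOn := by
    refine ContinuousOn.pow (ContinuousOn.inv₀ (Continuous.continuousOn ?_) fun p hp =>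
      one_sub_inner_ne_zero hp.1 (le_of_lt hp.2)) n
    exact continuous_const.sub (continuous_snd.inner continuous_fst)
  reproducing g hg r hr z hz := integral_sphere_mul_ballKernel hg hr hz

theorem boundedComp_ball [NeZero n] {φ : Cn n → Cn n} (hφ : IsHolSelfMap (unitBall n) φ)
    (hK : IsKernelOn (unitBall n)
      fun z w => ((1 - inner ℂ (φ w) (φ z)) / (1 - inner ℂ w z)) ^ n) :
    BoundedComp (ballHardySpace n) ballHardyNorm φ := by
  have := isProbabilityMeasure_sphereMeasure (n := n)
  refine isSzegoKernel_ball.boundedComp hφ (hK.congr fun z _ w _ => ?_)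
  simp only [ballKernel]
  rw [← div_pow, div_inv_eq_mul, div_eq_inv_mul]

end Ball

/-! ### Splitting an automorphism into an involution and a map fixing the origin. -/

section Factorization

variable {E : Type*} [NormedAddCommGroup E] [NormedSpace ℂ E] {D : Set E}

theorem IsHolSelfMap.comp {φ ψ : E → E} (hφ : IsHolSelfMap D φ) (hψ : IsHolSelfMap D ψ) :
    IsHolSelfMap D (φ ∘ ψ) :=
  ⟨hφ.1.comp hψ.1 hψ.2, hφ.2.comp hψ.2⟩

/-- On a domain with a family of involutive self-maps moving the origin to any given point, an
automorphism is the composition of one of them and an automorphism fixing the origin. -/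
theorem IsHolAut.exists_factorization (h0 : (0 : E) ∈ D) {m : E → E → E}
    (hm : ∀ a ∈ D, IsHolSelfMap D (m a)) (hinv : ∀ a ∈ D, ∀ z ∈ D, m a (m a z) = z)
    (hm0 : ∀ a ∈ D, m a 0 = a) {φ : E → E} (hφ : IsHolAut D φ) :
    ∃ a ∈ D, ∃ ψ χ : E → E, IsHolSelfMap D ψ ∧ IsHolSelfMap D χ ∧ Set.InvOn χ ψ D D ∧
      ψ 0 = 0 ∧ χ 0 = 0 ∧ ∀ z ∈ D, φ z = ψ (m a z) := by
  obtain ⟨hφ1, χ, hχ, hl, hr⟩ := hφ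
  have ha : χ 0 ∈ D := hχ.2 h0
  have hma := hm _ ha
  refine ⟨χ 0, ha, φ ∘ m (χ 0), m (χ 0) ∘ χ, hφ1.comp hma, hma.comp hχ, ⟨fun z hz => ?_,
    fun z hz => ?_⟩, ?_, ?_, fun z hz => ?_⟩
  · simp only [Function.comp_apply]
    rw [hl (hma.2 hz), hinv _ ha _ hz]
  · simp only [Function.comp_apply]
    rw [hinv _ ha _ (hχ.2 hz), hr hz]
  · simp only [Function.comp_apply]
    rw [hm0 _ ha, hr h0]
  · have := hinv _ ha 0 h0
    rwa [hm0 _ ha] at this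
  · simp only [Function.comp_apply]
    rw [hinv _ ha _ hz]

end Factorization

/-! ### Automorphisms of the ball. -/

section BallAut

variable {n : ℕ}

theorem unitBall_eq_ball : unitBall n = Metric.ball 0 1 := by
  ext z
  simp [unitBall]

/-- A holomorphic automorphism of the ball fixing the origin preserves inner products. -/
theorem inner_map_map_of_fix_zero {ψ χ : Cn n → Cn n} (hψ : IsHolSelfMap (unitBall n) ψ)
    (hχ : IsHolSelfMap (unitBall n) χ) (hinv : Set.InvOn χ ψ (unitBall n) (unitBall n))
    (hψ0 : ψ 0 = 0) (hχ0 : χ 0 = 0) {z w : Cn n} (hz : z ∈ unitBall n) (hw : w ∈ unitBall n) :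
    inner ℂ (ψ w) (ψ z) = inner ℂ w z := by
  rw [unitBall_eq_ball] at *
  have hle : ∀ {f : Cn n → Cn n}, IsHolSelfMap (Metric.ball 0 1) f → f 0 = 0 →
      ∀ z ∈ Metric.ball (0 : Cn n) 1, ‖f z‖ ≤ ‖z‖ := by
    intro f hf hf0 z hz
    exact Complex.norm_le_norm_of_mapsTo_ball hf.1 (hf.2.mono_right Metric.ball_subset_closedBall)
      hf0 (by simpa using hz)
  have hnorm : ∀ z ∈ Metric.ball (0 : Cn n) 1, ‖ψ z‖ = ‖z‖ := by
    intro z hz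
    refine le_antisymm (hle hψ hψ0 z hz) ?_
    have := hle hχ hχ0 _ (hψ.2 hz)
    rwa [hinv.1 hz] at this
  set L := fderiv ℂ ψ 0 with hL
  have hψd : HasFDerivAt ψ L 0 :=
    (hψ.1.differentiableAt (Metric.isOpen_ball.mem_nhds (by simp))).hasFDerivAt
  have hlin : ∀ z ∈ Metric.ball (0 : Cn n) 1, ψ z = L z := by
    intro z hz
    by_cases hz0 : z = 0
    · rw [hz0, hψ0, map_zero]
    have hzn : ‖z‖ ≠ 0 := norm_ne_zero_iff.2 hz0
    have hznc : (‖z‖ : ℂ) ≠ 0 := by exact_mod_cast hzn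
    set e : Cn n := (‖z‖ : ℂ)⁻¹ • z with he
    have hen : ‖e‖ = 1 := by simp [he, norm_smul, hzn]
    have hez : (‖z‖ : ℂ) • e = z := by rw [he, smul_smul, mul_inv_cancel₀ hznc, one_smul]
    set f : ℂ → Cn n := fun l => ψ (l • e) with hf
    have hmaps : Set.MapsTo (fun l : ℂ => l • e) (Metric.ball 0 1) (Metric.ball 0 1) := by
      intro l hl
      simpa [norm_smul, hen] using hl
    have hf0 : f 0 = 0 := by simp [hf, hψ0]
    have hfd : DifferentiableOn ℂ f (Metric.ball 0 1) :=
      hψ.1.comp (by fun_prop) hmaps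
    have hz1 : ((‖z‖ : ℝ) : ℂ) ∈ Metric.ball (0 : ℂ) 1 := by simpa using hz
    have hds : dslope f 0 (‖z‖ : ℂ) = (‖z‖ : ℂ)⁻¹ • ψ z := by
      rw [dslope_of_ne _ hznc, slope_def_module, hf0, sub_zero, sub_zero]
      simp only [hf, hez]
    -- Norm preservation is the equality case of the Schwarz lemma on the disc through `z`, so `ψ`
    -- is linear there, and its slope must be the derivative at `0`.
    have haff := Complex.affine_of_mapsTo_ball_of_norm_dslope_eq_div (R₂ := 1) hfd
      (by rw [hf0]; exact (hψ.2.comp hmaps).mono_right Metric.ball_subset_closedBall) hz1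
      (by rw [hds, norm_smul, hnorm z hz]; simp [hzn])
    simp only [hf0, zero_add, sub_zero, hds] at haff
    have h1 : HasDerivAt f ((‖z‖ : ℂ)⁻¹ • ψ z) 0 := by
      have h2 : HasDerivAt (fun l : ℂ => l • ((‖z‖ : ℂ)⁻¹ • ψ z)) ((‖z‖ : ℂ)⁻¹ • ψ z) 0 := by
        simpa using (hasDerivAt_id (0 : ℂ)).smul_const ((‖z‖ : ℂ)⁻¹ • ψ z)
      exact h2.congr_of_eventuallyEq
        (haff.eventuallyEq_of_mem (Metric.isOpen_ball.mem_nhds (by simp)))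
    have h2 : HasDerivAt f (L e) 0 := by
      have h3 : HasDerivAt (fun l : ℂ => l • e) e 0 := by
        simpa using (hasDerivAt_id (0 : ℂ)).smul_const e
      exact HasFDerivAt.comp_hasDerivAt_of_eq (0 : ℂ) hψd h3 (by simp)
    have h3 := h1.unique h2
    calc ψ z = (‖z‖ : ℂ) • ((‖z‖ : ℂ)⁻¹ • ψ z) := by
          rw [smul_smul, mul_inv_cancel₀ hznc, one_smul]
      _ = L z := by rw [h3, ← map_smul, hez]
  have hLn : ∀ v, ‖L v‖ = ‖v‖ := by
    intro v
    have hc : (0 : ℝ) < ‖v‖ + 1 := by positivity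
    have hcc : ((‖v‖ + 1 : ℝ) : ℂ) ≠ 0 := by exact_mod_cast hc.ne'
    set u : Cn n := ((‖v‖ + 1 : ℝ) : ℂ)⁻¹ • v with hu
    have hu1 : u ∈ Metric.ball (0 : Cn n) 1 := by
      rw [mem_ball_zero_iff, hu, norm_smul, norm_inv, Complex.norm_real,
        Real.norm_of_nonneg hc.le, inv_mul_lt_iff₀ hc]
      linarith
    have h := hnorm u hu1
    have huv : ((‖v‖ + 1 : ℝ) : ℂ) • u = v := by
      rw [hu, smul_smul, mul_inv_cancel₀ hcc, one_smul]
    rw [← huv, map_smul, norm_smul, norm_smul, ← hlin u hu1, h]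
  rw [hlin z hz, hlin w hw]
  exact LinearIsometry.inner_map_map (⟨L.toLinearMap, hLn⟩ : Cn n →ₗᵢ[ℂ] Cn n) w z

/-- The involutive automorphism of the ball that exchanges `0` and `a`. -/
def ballMobius (a z : Cn n) : Cn n :=
  (1 - inner ℂ a z)⁻¹ • (a - (√(1 - ‖a‖ ^ 2) : ℂ) • z -
    (inner ℂ a z / (1 + √(1 - ‖a‖ ^ 2)) : ℂ) • a)

theorem ballMobius_aux {a : Cn n} (ha : a ∈ unitBall n) :
    ∃ s : ℝ, 0 < s ∧ √(1 - ‖a‖ ^ 2) = s ∧ inner ℂ a a = 1 - (s : ℂ) ^ 2 ∧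
      (1 + (s : ℂ)) ≠ 0 := by
  have ha' : ‖a‖ < 1 := ha
  have h1 : 0 < 1 - ‖a‖ ^ 2 := by nlinarith [norm_nonneg a]
  have h2 : 0 < √(1 - ‖a‖ ^ 2) := Real.sqrt_pos.2 h1
  refine ⟨_, h2, rfl, ?_, ?_⟩
  · rw [← Complex.ofReal_pow, Real.sq_sqrt h1.le, inner_self_eq_norm_sq_to_K]
    push_cast
    ring_nf
    rfl
  · have : (1 + √(1 - ‖a‖ ^ 2)) ≠ 0 := by positivity
    exact_mod_cast this

/-- The factor in front of `1 - inner ℂ w z` splits into a function of `z` times the conjugate of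
the same function of `w`, which makes the quotient kernel of the involution rank-one. With `w = z`
it also shows that the ball is mapped into itself. -/
theorem one_sub_inner_ballMobius {a z w : Cn n} (ha : a ∈ unitBall n) (hz : z ∈ unitBall n)
    (hw : w ∈ unitBall n) :
    1 - inner ℂ (ballMobius a w) (ballMobius a z) =
      (√(1 - ‖a‖ ^ 2) : ℂ) ^ 2 * (1 - inner ℂ w z) /
        ((1 - inner ℂ a z) * (1 - inner ℂ w a)) := by
  obtain ⟨s, -, hs, haa, hs1⟩ := ballMobius_aux ha
  have h1 : 1 - inner ℂ a z ≠ 0 := one_sub_inner_ne_zero hz (le_of_lt ha)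
  have h2 : 1 - inner ℂ w a ≠ 0 := one_sub_inner_ne_zero ha (le_of_lt hw)
  simp only [ballMobius, hs, inner_smul_left, inner_smul_right, inner_sub_left, inner_sub_right,
    haa, map_sub, map_inv₀, map_div₀, map_add, map_one, Complex.conj_ofReal, inner_conj_symm]
  field_simp
  ring

theorem ballMobius_zero (a : Cn n) : ballMobius a 0 = a := by
  simp [ballMobius]

theorem ballMobius_ballMobius {a z : Cn n} (ha : a ∈ unitBall n) (hz : z ∈ unitBall n) :
    ballMobius a (ballMobius a z) = z := by
  obtain ⟨s, hs0, hs, haa, hs1⟩ := ballMobius_aux ha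
  have hsc : (s : ℂ) ≠ 0 := by exact_mod_cast hs0.ne'
  have h1 : 1 - inner ℂ a z ≠ 0 := one_sub_inner_ne_zero hz (le_of_lt ha)
  -- This is the only inner product that the outer application needs; afterwards the identity is
  -- checked coordinatewise.
  have h2 : inner ℂ a (ballMobius a z) = 1 - (s : ℂ) ^ 2 / (1 - inner ℂ a z) := by
    simp only [ballMobius, hs, inner_smul_right, inner_sub_right, haa]
    field_simp
    ring
  have h3 : ∀ x : Cn n, ballMobius a x = (1 - inner ℂ a x)⁻¹ • (a - (s : ℂ) • x -
    (inner ℂ a x / (1 + s) : ℂ) • a) := fun x => by rw [ballMobius, hs]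
  rw [h3 (ballMobius a z), h2, h3 z]
  ext i
  simp only [PiLp.smul_apply, PiLp.sub_apply, smul_eq_mul]
  field_simp
  ring

theorem isHolSelfMap_ballMobius {a : Cn n} (ha : a ∈ unitBall n) :
    IsHolSelfMap (unitBall n) (ballMobius a) := by
  have hd : Differentiable ℂ fun z : Cn n => inner ℂ a z := (innerSL ℂ a).differentiable
  refine ⟨?_, fun z hz => ?_⟩
  · have h1 : DifferentiableOn ℂ (fun z : Cn n => (1 - inner ℂ a z)⁻¹) (unitBall n) :=
      ((differentiable_const _).sub hd).differentiableOn.fun_inv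
        fun z hz => one_sub_inner_ne_zero hz (le_of_lt ha)
    have h2 : Differentiable ℂ fun z : Cn n => a - (√(1 - ‖a‖ ^ 2) : ℂ) • z :=
      (differentiable_const _).fun_sub (differentiable_id.fun_const_smul _)
    have h3 : Differentiable ℂ fun z : Cn n =>
        (inner ℂ a z / (1 + √(1 - ‖a‖ ^ 2)) : ℂ) • a := by
      simp only [div_eq_mul_inv]
      exact (hd.mul_const _).smul_const a
    exact h1.fun_smul (h2.fun_sub h3).differentiableOn
  · have h := one_sub_inner_ballMobius ha hz hz
    obtain ⟨s, hs0, hs, -, -⟩ := ballMobius_aux ha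
    have h1 : 1 - inner ℂ a z ≠ 0 := one_sub_inner_ne_zero hz (le_of_lt ha)
    have e1 : (1 - inner ℂ a z) * (1 - inner ℂ z a) = ((‖1 - inner ℂ a z‖ ^ 2 : ℝ) : ℂ) := by
      push_cast
      rw [← Complex.mul_conj', map_sub, map_one, inner_conj_symm]
    rw [e1, hs, inner_self_eq_norm_sq_to_K, inner_self_eq_norm_sq_to_K] at h
    have h' : 1 - ‖ballMobius a z‖ ^ 2 = s ^ 2 * (1 - ‖z‖ ^ 2) / ‖1 - inner ℂ a z‖ ^ 2 := by
      apply Complex.ofReal_injective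
      push_cast
      push_cast at h
      exact h
    have hz' : ‖z‖ < 1 := hz
    have h2 : 0 < 1 - ‖z‖ ^ 2 := by nlinarith [norm_nonneg z]
    have h3 : 0 < ‖1 - inner ℂ a z‖ := norm_pos_iff.2 h1
    have h4 : 0 < 1 - ‖ballMobius a z‖ ^ 2 := by rw [h']; positivity
    change ‖ballMobius a z‖ < 1
    exact lt_of_pow_lt_pow_left₀ 2 zero_le_one (by linarith)

theorem boundedComp_ball_of_isHolAut [NeZero n] {φ : Cn n → Cn n}
    (hφ : IsHolAut (unitBall n) φ) : BoundedComp (ballHardySpace n) ballHardyNorm φ := by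
  obtain ⟨a, ha, ψ, χ, hψ, hχ, hinv, hψ0, hχ0, hfac⟩ := hφ.exists_factorization
    (by simp [unitBall]) (fun a ha => isHolSelfMap_ballMobius ha)
    (fun a ha z hz => ballMobius_ballMobius ha hz) fun a _ => ballMobius_zero a
  refine boundedComp_ball hφ.1 ((isKernelOn_mul_conj _
    fun z => ((√(1 - ‖a‖ ^ 2) : ℂ) / (1 - inner ℂ a z)) ^ n).congr fun z hz w hw => ?_)
  have hm := isHolSelfMap_ballMobius ha
  rw [hfac z hz, hfac w hw, inner_map_map_of_fix_zero hψ hχ hinv hψ0 hχ0 (hm.2 hz) (hm.2 hw),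
    one_sub_inner_ballMobius ha hz hw]
  have h1 : 1 - inner ℂ a z ≠ 0 := one_sub_inner_ne_zero hz (le_of_lt ha)
  have h2 : 1 - inner ℂ w a ≠ 0 := one_sub_inner_ne_zero ha (le_of_lt hw)
  have h3 : 1 - inner ℂ w z ≠ 0 := one_sub_inner_ne_zero hz (le_of_lt hw)
  rw [map_pow, ← mul_pow, map_div₀, map_sub, map_one, inner_conj_symm, Complex.conj_ofReal]
  congr 1
  field_simp

end BallAut

/-! ### Automorphisms of the polydisc. -/

section PolydiscAut

variable {n : ℕ}

theorem polydisc_eq_ball : polydisc n = Metric.ball 0 1 := by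
  ext z
  rw [mem_ball_zero_iff, pi_norm_lt_iff one_pos]
  rfl

/-- A linear isometry for the supremum norm is a permutation of the coordinates, up to unimodular
factors. -/
theorem exists_perm_of_norm_map {L : (Fin n → ℂ) →ₗ[ℂ] (Fin n → ℂ)} (hL : ∀ v, ‖L v‖ = ‖v‖) :
    ∃ (σ : Equiv.Perm (Fin n)) (ε : Fin n → ℂ), (∀ i, ‖ε i‖ = 1) ∧
      ∀ v i, L v i = ε i * v (σ i) := by
  set A : Fin n → Fin n → ℂ := fun i j => L (Pi.single j 1) i with hA
  have hex : ∀ j, ∃ i, ‖A i j‖ = 1 := by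
    intro j
    have h1 : ‖L (Pi.single j 1)‖ = 1 := by
      rw [hL, Pi.norm_single, norm_one]
    by_contra! hne
    have : ‖L (Pi.single j 1)‖ < 1 := (pi_norm_lt_iff one_pos).2 fun i =>
      lt_of_le_of_ne ((norm_le_pi_norm _ i).trans_eq h1) (hne i)
    exact this.ne h1
  choose τ hτ using hex
  -- A row with a unimodular entry has no other nonzero entry. The phase `u` aligns the two
  -- contributions: a vector of sup norm at most `1` would have `i`-th image entry of modulus `1 +
  -- ‖A i j'‖²`.
  have hzero : ∀ i j j', ‖A i j‖ = 1 → j' ≠ j → A i j' = 0 := by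
    intro i j j' h1 hj
    set u : ℂ := conj (A i j') * A i j with hu
    have hA1 : ‖A i j'‖ ≤ 1 := by
      refine (norm_le_pi_norm (L (Pi.single j' 1)) i).trans_eq ?_
      rw [hL, Pi.norm_single, norm_one]
    have hun : ‖u‖ ≤ 1 := by
      rw [hu, norm_mul, RCLike.norm_conj, h1, mul_one]
      exact hA1
    have hv : ‖(Pi.single j 1 + u • Pi.single j' 1 : Fin n → ℂ)‖ ≤ 1 := by
      refine (pi_norm_le_iff_of_nonneg zero_le_one).2 fun l => ?_
      by_cases hl : l = j
      · subst hl
        simp [Pi.single_eq_of_ne hj.symm]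
      · by_cases hl' : l = j'
        · subst hl'
          simpa [Pi.single_eq_of_ne hl] using hun
        · simp [Pi.single_eq_of_ne hl, Pi.single_eq_of_ne hl']
    have h2 : L (Pi.single j 1 + u • Pi.single j' 1) i = A i j * ((1 + ‖A i j'‖ ^ 2 : ℝ) : ℂ) := by
      rw [map_add, map_smul, Pi.add_apply, Pi.smul_apply, smul_eq_mul]
      change A i j + u * A i j' = _
      push_cast
      rw [hu, ← Complex.conj_mul']
      ring
    have h3 := (norm_le_pi_norm (L (Pi.single j 1 + u • Pi.single j' 1)) i).trans_eq (hL _)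
    rw [h2, norm_mul, h1, one_mul, Complex.norm_real, Real.norm_of_nonneg (by positivity)] at h3
    have h4 : ‖A i j'‖ ^ 2 = 0 := le_antisymm (by linarith) (by positivity)
    simpa using h4
  have hinj : Function.Injective τ := by
    intro j j' hjj
    by_contra hne
    have := hzero (τ j) j j' (hτ j) (Ne.symm hne)
    rw [hjj] at this
    have h1 := hτ j'
    rw [this, norm_zero] at h1
    exact zero_ne_one h1
  set σ : Equiv.Perm (Fin n) := (Equiv.ofBijective τ (Finite.injective_iff_bijective.1 hinj)).symm
    with hσ
  have hτσ : ∀ i, τ (σ i) = i := fun i => Equiv.apply_symm_apply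
    (Equiv.ofBijective τ (Finite.injective_iff_bijective.1 hinj)) i
  have hε : ∀ i, ‖A i (σ i)‖ = 1 := fun i => by
    have := hτ (σ i)
    rwa [hτσ] at this
  refine ⟨σ, fun i => A i (σ i), hε, fun v i => ?_⟩
  have h1 : L v = ∑ j, v j • L (Pi.single j 1) := by
    refine (LinearMap.pi_apply_eq_sum_univ L v).trans (Finset.sum_congr rfl fun j _ => ?_)
    congr 2
    funext l
    simp [Pi.single_apply, eq_comm]
  rw [h1, Finset.sum_apply, Finset.sum_eq_single (σ i)]
  · simp [hA, mul_comm]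
  · intro j _ hj
    rw [Pi.smul_apply, smul_eq_mul]
    change v j * A i j = 0
    rw [hzero i (σ i) j (hε i) hj, mul_zero]
  · simp

/-- A holomorphic automorphism of the polydisc fixing the origin is a permutation of the
coordinates, up to unimodular factors. -/
theorem exists_perm_of_fix_zero {ψ χ : (Fin n → ℂ) → (Fin n → ℂ)}
    (hψ : IsHolSelfMap (polydisc n) ψ) (hχ : IsHolSelfMap (polydisc n) χ)
    (hinv : Set.InvOn χ ψ (polydisc n) (polydisc n)) (hψ0 : ψ 0 = 0) (hχ0 : χ 0 = 0) :
    ∃ (σ : Equiv.Perm (Fin n)) (ε : Fin n → ℂ), (∀ i, ‖ε i‖ = 1) ∧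
      ∀ z ∈ polydisc n, ∀ i, ψ z i = ε i * z (σ i) := by
  rw [polydisc_eq_ball] at *
  have hball : ∀ r : ℝ, 0 < r → Metric.ball (0 : Fin n → ℂ) r ∈ nhds 0 :=
    fun r hr => Metric.ball_mem_nhds 0 hr
  have hder : ∀ {f : (Fin n → ℂ) → (Fin n → ℂ)}, IsHolSelfMap (Metric.ball 0 1) f → f 0 = 0 →
      HasFDerivAt f (fderiv ℂ f 0) 0 ∧ ‖fderiv ℂ f 0‖ ≤ 1 := by
    intro f hf hf0
    refine ⟨(hf.1.differentiableAt (hball 1 one_pos)).hasFDerivAt, ?_⟩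
    refine Complex.norm_fderiv_le_one_of_mapsTo_ball hf.1 ?_ one_pos
    rw [hf0]
    exact hf.2.mono_right Metric.ball_subset_closedBall
  obtain ⟨hL, hL1⟩ := hder hψ hψ0
  obtain ⟨hM, hM1⟩ := hder hχ hχ0
  set L := fderiv ℂ ψ 0
  set M := fderiv ℂ χ 0
  have hML : ∀ v, M (L v) = v := by
    have h1 : HasFDerivAt (χ ∘ ψ) (M.comp L) 0 := HasFDerivAt.comp 0 (by rwa [hψ0]) hL
    have h2 : HasFDerivAt (χ ∘ ψ) (ContinuousLinearMap.id ℂ (Fin n → ℂ)) 0 :=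
      (hasFDerivAt_id 0).congr_of_eventuallyEq
        (Filter.eventuallyEq_of_mem (hball 1 one_pos) fun z hz => hinv.1 hz)
    intro v
    exact congrArg (fun T : (Fin n → ℂ) →L[ℂ] (Fin n → ℂ) => T v) (h1.unique h2)
  -- The derivatives of `ψ` and of its inverse at `0` are mutually inverse contractions, so both are
  -- isometries.
  have hLn : ∀ v, ‖L v‖ = ‖v‖ := by
    intro v
    refine le_antisymm ((L.le_of_opNorm_le hL1 v).trans_eq (one_mul _)) ?_
    have := (M.le_of_opNorm_le hM1 (L v)).trans_eq (one_mul _)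
    rwa [hML] at this
  obtain ⟨σ, ε, hε, hLσ⟩ := exists_perm_of_norm_map (L := L.toLinearMap) hLn
  refine ⟨σ, ε, hε, ?_⟩
  -- When `z (σ i)` has maximal modulus, scaling it to `1` gives a disc through `z` inside the
  -- polydisc. On it the `i`-th component of `ψ` has derivative `ε i` of modulus `1` at `0`, the
  -- equality case of the Schwarz lemma.
  have hdom : ∀ z ∈ Metric.ball (0 : Fin n → ℂ) 1, ∀ i, z (σ i) ≠ 0 → (∀ j, ‖z j‖ ≤ ‖z (σ i)‖) →
      ψ z i = ε i * z (σ i) := by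
    intro z hz i hne hle
    set u : Fin n → ℂ := (z (σ i))⁻¹ • z with hu
    have hun : ‖u‖ ≤ 1 := by
      refine (pi_norm_le_iff_of_nonneg zero_le_one).2 fun j => ?_
      rw [hu, Pi.smul_apply, norm_smul, norm_inv]
      exact inv_mul_le_one_of_le₀ (hle j) (norm_nonneg _)
    have huz : z (σ i) • u = z := by rw [hu, smul_smul, mul_inv_cancel₀ hne, one_smul]
    have huσ : u (σ i) = 1 := by
      rw [hu, Pi.smul_apply, smul_eq_mul, inv_mul_cancel₀ hne]
    set f : ℂ → ℂ := fun l => ψ (l • u) i with hf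
    have hmaps : Set.MapsTo (fun l : ℂ => l • u) (Metric.ball 0 1) (Metric.ball 0 1) := by
      intro l hl
      rw [mem_ball_zero_iff] at hl ⊢
      rw [norm_smul]
      exact (mul_le_of_le_one_right (norm_nonneg _) hun).trans_lt hl
    have hfd : DifferentiableOn ℂ f (Metric.ball 0 1) :=
      (differentiableOn_pi.1 (hψ.1.comp (by fun_prop) hmaps)) i
    have hf0 : f 0 = 0 := by simp [hf, hψ0]
    have hfm : Set.MapsTo f (Metric.ball 0 1) (Metric.closedBall (f 0) 1) := by
      intro l hl
      rw [hf0, mem_closedBall_zero_iff]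
      refine (norm_le_pi_norm (ψ (l • u)) i).trans (le_of_lt ?_)
      simpa using hψ.2 (hmaps hl)
    have hderiv : HasDerivAt f (ε i) 0 := by
      have h3 : HasDerivAt (fun l : ℂ => l • u) u 0 := by
        simpa using (hasDerivAt_id (0 : ℂ)).smul_const u
      have h4 : HasDerivAt (fun l : ℂ => ψ (l • u)) (L u) 0 :=
        HasFDerivAt.comp_hasDerivAt_of_eq (0 : ℂ) hL h3 (by simp)
      have h5 := hasDerivAt_pi.1 h4 i
      have h6 : L u i = ε i := by
        have := hLσ u i
        rwa [huσ, mul_one] at this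
      rwa [h6] at h5
    have hds : dslope f 0 0 = ε i := by rw [dslope_same, hderiv.deriv]
    have haff := Complex.affine_of_mapsTo_ball_of_norm_dslope_eq_div (R₂ := 1) hfd hfm
      (z₀ := 0) (by simp) (by rw [hds, hε]; simp)
    have hzσ : z (σ i) ∈ Metric.ball (0 : ℂ) 1 := by
      rw [mem_ball_zero_iff] at hz ⊢
      exact (norm_le_pi_norm z _).trans_lt hz
    have h7 := haff hzσ
    simp only [hds, hf0, zero_add, sub_zero, smul_eq_mul] at h7
    simp only [hf, huz] at h7
    rw [h7, mul_comm]
  intro z hz i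
  have hz1 : ‖z‖ < 1 := by simpa using hz
  -- For general `z`, let the coordinate `σ i` vary. It is dominant once `‖z‖ < ‖l‖`, so `q l = ε i
  -- * l` near `ρ`, and the identity theorem extends this to the whole disc.
  set q : ℂ → ℂ := fun l => ψ (Function.update z (σ i) l) i with hq
  have hmaps : Set.MapsTo (fun l : ℂ => Function.update z (σ i) l) (Metric.ball 0 1)
      (Metric.ball 0 1) := by
    intro l hl
    rw [mem_ball_zero_iff] at hl ⊢
    refine (pi_norm_lt_iff one_pos).2 fun j => ?_
    by_cases hj : j = σ i
    · subst hj; simpa using hl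
    · change ‖Function.update z (σ i) l j‖ < 1
      rw [Function.update_of_ne hj]
      exact (norm_le_pi_norm z j).trans_lt hz1
  have hud : Differentiable ℂ fun l : ℂ => Function.update z (σ i) l := by
    refine differentiable_pi.2 fun j => ?_
    by_cases hj : j = σ i
    · subst hj; simp
    · simp [hj]
  have hqd : DifferentiableOn ℂ q (Metric.ball 0 1) :=
    (differentiableOn_pi.1 (hψ.1.comp hud.differentiableOn hmaps)) i
  obtain ⟨ρ, hρ1, hρ2⟩ := exists_between hz1
  have hρ0 : 0 < ρ := (norm_nonneg _).trans_lt hρ1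
  have hρn : ‖(ρ : ℂ)‖ = ρ := by rw [Complex.norm_real, Real.norm_of_nonneg hρ0.le]
  have hev : q =ᶠ[nhds (ρ : ℂ)] fun l => ε i * l := by
    have ho : {l : ℂ | ‖z‖ < ‖l‖ ∧ ‖l‖ < 1} ∈ nhds (ρ : ℂ) := by
      refine IsOpen.mem_nhds ?_ ⟨by rwa [hρn], by rwa [hρn]⟩
      exact (isOpen_lt continuous_const continuous_norm).inter
        (isOpen_lt continuous_norm continuous_const)
    filter_upwards [ho] with l hl
    have hm : Function.update z (σ i) l ∈ Metric.ball (0 : Fin n → ℂ) 1 :=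
      hmaps (by simpa using hl.2)
    have h1 := hdom _ hm i (by
      rw [Function.update_self]
      exact norm_pos_iff.1 ((norm_nonneg _).trans_lt hl.1)) (by
      intro j
      rw [Function.update_self]
      by_cases hj : j = σ i
      · subst hj; simp
      · rw [Function.update_of_ne hj]
        exact (norm_le_pi_norm z j).trans hl.1.le)
    rwa [Function.update_self] at h1
  have heq := AnalyticOnNhd.eqOn_of_preconnected_of_eventuallyEq
    (hqd.analyticOnNhd Metric.isOpen_ball)
    ((differentiable_id.const_mul (ε i)).differentiableOn.analyticOnNhd Metric.isOpen_ball)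
    (convex_ball (0 : ℂ) 1).isPreconnected (z₀ := (ρ : ℂ)) (by
      rw [mem_ball_zero_iff, hρn]; exact hρ2) hev
  have hzσ : z (σ i) ∈ Metric.ball (0 : ℂ) 1 := by
    rw [mem_ball_zero_iff]
    exact (norm_le_pi_norm z _).trans_lt hz1
  have h := heq hzσ
  simpa [hq] using h

/-- The involutive automorphism of the polydisc that exchanges `0` and `a`. -/
def polydiscMobius (a z : Fin n → ℂ) (i : Fin n) : ℂ := (a i - z i) / (1 - z i * conj (a i))

theorem polydiscMobius_zero (a : Fin n → ℂ) : polydiscMobius a 0 = a := by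
  funext i
  simp [polydiscMobius]

theorem one_sub_polydiscMobius {a z w : Fin n → ℂ} (ha : a ∈ polydisc n) (hz : z ∈ polydisc n)
    (hw : w ∈ polydisc n) (i : Fin n) :
    1 - conj (polydiscMobius a w i) * polydiscMobius a z i =
      ((1 - ‖a i‖ ^ 2 : ℝ) : ℂ) * (1 - conj (w i) * z i) /
        ((1 - z i * conj (a i)) * (1 - a i * conj (w i))) := by
  have h1 : 1 - z i * conj (a i) ≠ 0 := one_sub_mul_conj_ne_zero (hz i) (ha i).le
  have h2 : 1 - a i * conj (w i) ≠ 0 := one_sub_mul_conj_ne_zero (ha i) (hw i).le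
  have h1' : 1 - conj (a i) * z i ≠ 0 := by rwa [mul_comm]
  have h2' : 1 - conj (w i) * a i ≠ 0 := by rwa [mul_comm]
  have e : ((1 - ‖a i‖ ^ 2 : ℝ) : ℂ) = 1 - a i * conj (a i) := by
    rw [Complex.mul_conj']; push_cast; rfl
  simp only [polydiscMobius, e, map_div₀, map_sub, map_mul, map_one, Complex.conj_conj]
  field_simp
  ring

theorem polydiscMobius_polydiscMobius {a z : Fin n → ℂ} (ha : a ∈ polydisc n)
    (hz : z ∈ polydisc n) : polydiscMobius a (polydiscMobius a z) = z := by
  funext i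
  have h1 : 1 - z i * conj (a i) ≠ 0 := one_sub_mul_conj_ne_zero (hz i) (ha i).le
  have h2 : 1 - a i * conj (a i) ≠ 0 := one_sub_mul_conj_ne_zero (ha i) (ha i).le
  have h3 : 1 - (a i - z i) / (1 - z i * conj (a i)) * conj (a i) =
      (1 - a i * conj (a i)) / (1 - z i * conj (a i)) := by
    field_simp
    ring
  simp only [polydiscMobius]
  rw [h3, div_eq_iff (div_ne_zero h2 h1)]
  field_simp
  ring

theorem isHolSelfMap_polydiscMobius {a : Fin n → ℂ} (ha : a ∈ polydisc n) :
    IsHolSelfMap (polydisc n) (polydiscMobius a) := by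
  refine ⟨differentiableOn_pi.2 fun i => ?_, fun z hz i => ?_⟩
  · have h1 : Differentiable ℂ fun z : Fin n → ℂ => a i - z i := by fun_prop
    have h2 : Differentiable ℂ fun z : Fin n → ℂ => 1 - z i * conj (a i) := by fun_prop
    have h3 : DifferentiableOn ℂ (fun z : Fin n → ℂ => (1 - z i * conj (a i))⁻¹) (polydisc n) :=
      h2.differentiableOn.fun_inv fun z hz => one_sub_mul_conj_ne_zero (hz i) (ha i).le
    simp only [polydiscMobius, div_eq_mul_inv]
    exact h1.differentiableOn.fun_mul h3
  · have h := one_sub_polydiscMobius ha hz hz i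
    have h1 : 1 - z i * conj (a i) ≠ 0 := one_sub_mul_conj_ne_zero (hz i) (ha i).le
    have e1 : (1 - z i * conj (a i)) * (1 - a i * conj (z i)) =
        ((‖1 - z i * conj (a i)‖ ^ 2 : ℝ) : ℂ) := by
      push_cast
      rw [← Complex.mul_conj', map_sub, map_one, map_mul, Complex.conj_conj, mul_comm (a i)]
    rw [e1, Complex.conj_mul', Complex.conj_mul'] at h
    have h' : 1 - ‖polydiscMobius a z i‖ ^ 2 =
        (1 - ‖a i‖ ^ 2) * (1 - ‖z i‖ ^ 2) / ‖1 - z i * conj (a i)‖ ^ 2 := by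
      exact_mod_cast h
    have hz' := hz i
    have ha' := ha i
    have h2 : 0 < 1 - ‖z i‖ ^ 2 := by nlinarith [norm_nonneg (z i)]
    have h3 : 0 < 1 - ‖a i‖ ^ 2 := by nlinarith [norm_nonneg (a i)]
    have h4 : 0 < ‖1 - z i * conj (a i)‖ := norm_pos_iff.2 h1
    have h5 : 0 < 1 - ‖polydiscMobius a z i‖ ^ 2 := by rw [h']; positivity
    exact lt_of_pow_lt_pow_left₀ 2 zero_le_one (by linarith)

theorem boundedComp_polydisc_of_isHolAut {φ : (Fin n → ℂ) → (Fin n → ℂ)}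
    (hφ : IsHolAut (polydisc n) φ) :
    BoundedComp (polydiscHardySpace n) polydiscHardyNorm φ := by
  obtain ⟨a, ha, ψ, χ, hψ, hχ, hinv, hψ0, hχ0, hfac⟩ := hφ.exists_factorization
    (by simp [polydisc]) (fun a ha => isHolSelfMap_polydiscMobius ha)
    (fun a ha z hz => polydiscMobius_polydiscMobius ha hz) fun a _ => polydiscMobius_zero a
  obtain ⟨σ, ε, hε, hσ⟩ := exists_perm_of_fix_zero hψ hχ hinv hψ0 hχ0
  refine boundedComp_polydisc n hφ.1 ((isKernelOn_mul_conj _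
    fun z => ∏ i, (√(1 - ‖a i‖ ^ 2) : ℂ) / (1 - z i * conj (a i))).congr fun z hz w hw => ?_)
  have hm := isHolSelfMap_polydiscMobius ha
  have h1 : ∏ i, (1 - conj (φ w i) * φ z i) =
      ∏ i, (1 - conj (polydiscMobius a w i) * polydiscMobius a z i) := by
    -- The permutation only reorders the factors, and the unimodular `ε i` cancel against their
    -- conjugates.
    rw [← Equiv.prod_comp σ fun i => 1 - conj (polydiscMobius a w i) * polydiscMobius a z i]
    refine Finset.prod_congr rfl fun i _ => ?_
    have h : conj (ε i) * ε i = 1 := by rw [Complex.conj_mul', hε]; simp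
    rw [hfac z hz, hfac w hw, hσ _ (hm.2 hz), hσ _ (hm.2 hw), map_mul]
    linear_combination
      (-(conj (polydiscMobius a w (σ i)) * polydiscMobius a z (σ i))) * h
  rw [Finset.prod_div_distrib (f := fun i => 1 - conj (φ w i) * φ z i), h1,
    ← Finset.prod_div_distrib, map_prod, ← Finset.prod_mul_distrib]
  refine Finset.prod_congr rfl fun i _ => ?_
  have h3 : 1 - z i * conj (a i) ≠ 0 := one_sub_mul_conj_ne_zero (hz i) (ha i).le
  have h4 : 1 - a i * conj (w i) ≠ 0 := one_sub_mul_conj_ne_zero (ha i) (hw i).le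
  have h5 : 1 - z i * conj (w i) ≠ 0 := one_sub_mul_conj_ne_zero (hz i) (hw i).le
  have h6 : (√(1 - ‖a i‖ ^ 2) : ℂ) * (√(1 - ‖a i‖ ^ 2) : ℂ) = ((1 - ‖a i‖ ^ 2 : ℝ) : ℂ) := by
    have ha' := ha i
    rw [← Complex.ofReal_mul, Real.mul_self_sqrt (by nlinarith [norm_nonneg (a i)])]
  rw [one_sub_polydiscMobius ha hz hw, map_div₀, Complex.conj_ofReal, map_sub, map_one, map_mul,
    Complex.conj_conj, ← h6, mul_comm (conj (w i)) (z i)]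
  field_simp

end PolydiscAut

end HardyComp

end

theorem corollary4p4 (n : ℕ) (hn : 1 ≤ n) :
    (∀ φ : (Fin n → ℂ) → (Fin n → ℂ), HardyComp.IsHolSelfMap (HardyComp.polydisc n) φ →
      HardyComp.IsKernelOn (HardyComp.polydisc n)
        (fun z w => ∏ i, (1 - conj (φ w i) * φ z i) / (1 - conj (w i) * z i)) →
      HardyComp.BoundedComp (HardyComp.polydiscHardySpace n) HardyComp.polydiscHardyNorm φ) ∧
    -- Mathlib's inner product is conjugate-linear in its first argument
    (∀ φ : HardyComp.Cn n → HardyComp.Cn n, HardyComp.IsHolSelfMap (HardyComp.unitBall n) φ →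
      HardyComp.IsKernelOn (HardyComp.unitBall n)
        (fun z w => ((1 - inner ℂ (φ w) (φ z)) / (1 - inner ℂ w z)) ^ n) →
      HardyComp.BoundedComp (HardyComp.ballHardySpace n) HardyComp.ballHardyNorm φ) ∧
    (∀ φ : (Fin n → ℂ) → (Fin n → ℂ), HardyComp.IsHolAut (HardyComp.polydisc n) φ →
      HardyComp.BoundedComp (HardyComp.polydiscHardySpace n) HardyComp.polydiscHardyNorm φ) ∧
    (∀ φ : HardyComp.Cn n → HardyComp.Cn n, HardyComp.IsHolAut (HardyComp.unitBall n) φ →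
      HardyComp.BoundedComp (HardyComp.ballHardySpace n) HardyComp.ballHardyNorm φ) := by
  have : NeZero n := ⟨by omega⟩
  exact ⟨fun φ hφ hK => HardyComp.boundedComp_polydisc n hφ hK,
    fun φ hφ hK => HardyComp.boundedComp_ball hφ hK,
    fun φ hφ => HardyComp.boundedComp_polydisc_of_isHolAut hφ,
    fun φ hφ => HardyComp.boundedComp_ball_of_isHolAut hφ⟩
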